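/- **Setting.** Let $\mathbb T=\mathbb R/\mathbb Z$ carry its Haar probability measure $\mu$. For $\lambda=(\lambda_1,\lambda_2,\lambda_3)\in\mathbb R^3$ and irrational $\alpha\in\mathbb R$ let $$c_\lambda(\theta)=\lambda_1e^{-2\pi i(\theta+\alpha/2)}+\lambda_2+\lambda_3e^{2\pi i(\theta+\alpha/2)},\qquad I(\lambda)=\int_{\mathbb T}\log|c_\lambda|\,d\mu ,$$ and let $H_{\theta;\lambda,\alpha}$ be the operator on $\ell^2(\mathbb Z)$ given by $$(H_{\theta;\lambda,\alpha}\psi)_k=2\cos(2\pi(\theta+k\alpha))\,\psi_k+c_\lambda(\theta+k\alpha)\,\psi_{k+1}+\overline{c_\lambda(\theta+(k-1)\alpha)}\,\psi_{k-1}.$$ Call $\theta\in\mathbb T$ *$\alpha$-rational* if $(\mathbb Z\alpha+2\theta)\cap\mathbb Z\neq\emptyset$. For $\lambda=(\lambda_1,0,\lambda_3)$ put $\sigma(\lambda)=(\lambda_3,1,\lambda_1)$ and $c=c_{\sigma(\lambda)}$. For $E\in\mathbb R$ and $n\in\mathbb N$ let $$\widetilde B^E(x)=\frac1{c(x)}\begin{pmatrix}E&-\overline{c(x-\alpha)}\\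 c(x)&0\end{pmatrix},\quad \widetilde B^E_n(x)=\widetilde B^E(x+(n-1)\alpha)\cdots\widetilde B^E(x),\quad R_\theta=\begin{pmatrix}e^{2\pi i\theta}&0\\0&e^{-2\pi i\theta}\end{pmatrix},$$ $$d^{(n)}(x)=\prod_{j=0}^{n-1}c(x+j\alpha),\qquad \Psi^{(n)}(x)=\operatorname{tr}\bigl\{d^{(n)}(x)\bigl(\widetilde B^E_n(x)-R_\theta^n\bigr)\bigr\},$$ and let $\widehat{\Psi^{(n)}}(k)$, $k\in\mathbb Z$, be the Fourier coefficients of $\Psi^{(n)}$ (which is defined for all but finitely many $x$). Let $q_n$ be the denominators of the continued fraction approximants of $\alpha$. Call a subsequence $(q_{n_l})$ of $(q_n)$ *admissible* if there is a constant $C$ such that for all $l$ and all $x\in\mathbb T$ $$\frac1{q_{n_l}}\sum_{j=0}^{q_{n_l}-1}\log|c(x+j\alpha)|-I(\sigma(\lambda))\le\frac C{q_{n_l}}\qquad(\log 0=-\infty),$$ and for such a subsequence let $(m_l)=(q_{n_1},2q_{n_1},q_{n_2},2q_{n_2},\dots)$. **Theorem.** Let $\alpha$ be irrational and $\lambda=(\lambda_1,0,\lambda_3)$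 with $\lambda_1,\lambda_3\in\mathbb R$ and $\lambda_1+\lambda_3\ge1$. Admissible subsequences exist, and for every admissible subsequence the following holds for $\mu$-a.e. $\theta$ and every $E\in\mathbb R$: if $\lambda_1\ge\lambda_3$, then $$\limsup_{l\to\infty}e^{-m_lI(\sigma(\lambda))}\bigl|\widehat{\Psi^{(m_l)}}(m_l)\bigr|>0,$$ and if $\lambda_3\ge\lambda_1$, then $$\limsup_{l\to\infty}e^{-m_lI(\sigma(\lambda))}\bigl|\widehat{\Psi^{(m_l)}}(-m_l)\bigr|>0.$$ Moreover, for $\mu$-a.e. $\theta\in\mathbb T$ that is not $\alpha$-rational, $H_{\theta;\lambda,\alpha}$ has empty point spectrum (no eigenvalues). -/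

import Mathlib

namespace EHM

open MeasureTheory Filter
open scoped ComplexConjugate

noncomputable section

/-- A coupling triple `(l1, l2, l3)`: `l2` is the nearest neighbour coupling,
`l1` and `l3` are the next-nearest neighbour couplings. -/
structure Coupling where
  l1 : ℝ
  l2 : ℝ
  l3 : ℝ

/-- The sampling function
`c_lam(θ) = l1 e^{-2πi(θ + α/2)} + l2 + l3 e^{2πi(θ + α/2)}` on the circle `ℝ/ℤ`.
Here `fourier n x = e^{2πinx}`. -/
def c (lam : Coupling) (α : ℝ) (θ : UnitAddCircle) : ℂ :=
  (lam.l1 : ℂ) * fourier (-1) (θ + ((α / 2 : ℝ) : UnitAddCircle)) + (lam.l2 : ℂ)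
    + (lam.l3 : ℂ) * fourier 1 (θ + ((α / 2 : ℝ) : UnitAddCircle))

/-- The potential `v(θ) = 2 cos(2πθ) = e^{2πiθ} + e^{-2πiθ}`. -/
def v (θ : UnitAddCircle) : ℂ := fourier 1 θ + fourier (-1) θ

/-- The point `θ + k α` of the circle, for an integer `k`. -/
def rot (α : ℝ) (k : ℤ) (θ : UnitAddCircle) : UnitAddCircle :=
  θ + (((k : ℝ) * α : ℝ) : UnitAddCircle)

/-- The action of the Jacobi matrix of extended Harper's model on a two-sided sequence. -/
def jacobi (lam : Coupling) (α : ℝ) (θ : UnitAddCircle) (ψ : ℤ → ℂ) (k : ℤ) : ℂ :=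
  v (rot α k θ) * ψ k + c lam α (rot α k θ) * ψ (k + 1)
    + conj (c lam α (rot α (k - 1) θ)) * ψ (k - 1)

theorem norm_v_le (θ : UnitAddCircle) : ‖v θ‖ ≤ 2 := by
  unfold v
  refine (norm_add_le _ _).trans ?_
  have h (n : ℤ) : ‖fourier n θ‖ = 1 := Circle.norm_coe _
  rw [h, h]
  norm_num

theorem norm_c_le (lam : Coupling) (α : ℝ) (θ : UnitAddCircle) :
    ‖c lam α θ‖ ≤ |lam.l1| + |lam.l2| + |lam.l3| := by
  have h (n : ℤ) (x : UnitAddCircle) : ‖fourier n x‖ = 1 := Circle.norm_coe _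
  unfold c
  refine (norm_add₃_le).trans ?_
  simp only [norm_mul, h, Complex.norm_real, Real.norm_eq_abs, mul_one]
  exact le_rfl

/-- Bounded multiples of shifts of square-summable sequences are square-summable. -/
theorem memℓp_mul_shift {ψ : ℤ → ℂ} (hψ : Memℓp ψ 2) (a : ℤ → ℂ) (C : ℝ)
    (ha : ∀ k, ‖a k‖ ≤ C) (j : ℤ) : Memℓp (fun k => a k * ψ (k + j)) 2 := by
  have h2 : (0 : ℝ) < (2 : ENNReal).toReal := by norm_num
  rw [memℓp_gen_iff h2] at hψ ⊢
  have hs : Summable fun k : ℤ => ‖ψ (k + j)‖ ^ (2 : ENNReal).toReal :=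
    hψ.comp_injective (add_left_injective j)
  have hC : 0 ≤ C := (norm_nonneg _).trans (ha 0)
  refine Summable.of_nonneg_of_le (fun k => by positivity) (fun k => ?_)
    (hs.mul_left (C ^ (2 : ENNReal).toReal))
  rw [norm_mul, Real.mul_rpow (norm_nonneg _) (norm_nonneg _)]
  gcongr
  exact ha k

theorem memℓp_jacobi (lam : Coupling) (α : ℝ) (θ : UnitAddCircle) {ψ : ℤ → ℂ}
    (hψ : Memℓp ψ 2) : Memℓp (jacobi lam α θ ψ) 2 := by
  have h0 := memℓp_mul_shift hψ (fun k => v (rot α k θ)) 2 (fun k => norm_v_le _) 0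
  have h1 := memℓp_mul_shift hψ (fun k => c lam α (rot α k θ)) _
    (fun k => norm_c_le lam α _) 1
  have h2 := memℓp_mul_shift hψ (fun k => conj (c lam α (rot α (k - 1) θ))) _
    (fun k => (RCLike.norm_conj _).le.trans (norm_c_le lam α _)) (-1)
  have h := (h0.add h1).add h2
  simp only [add_zero] at h
  exact h

/-- Extended Harper's model `H_{θ;lam,α}` as a linear operator on `ℓ²(ℤ)`. -/
def H (lam : Coupling) (α : ℝ) (θ : UnitAddCircle) :
    lp (fun _ : ℤ => ℂ) 2 →ₗ[ℂ] lp (fun _ : ℤ => ℂ) 2 where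
  toFun ψ := ⟨jacobi lam α θ ψ, memℓp_jacobi lam α θ (lp.memℓp ψ)⟩
  map_add' ψ φ := by
    ext k
    simp only [jacobi, lp.coeFn_add, Pi.add_apply]
    ring
  map_smul' r ψ := by
    ext k
    simp only [jacobi, lp.coeFn_smul, Pi.smul_apply, smul_eq_mul, RingHom.id_apply]
    ring

/-- The point spectrum: the set of eigenvalues of an operator. -/
def pointSpectrum {V : Type*} [AddCommGroup V] [Module ℂ V] (T : V →ₗ[ℂ] V) : Set ℂ :=
  {E | Module.End.HasEigenvalue T E}

/-- `θ` is `α`-rational if `(ℤα + 2θ) ∩ ℤ` is non-empty. -/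
def IsAlphaRational (α : ℝ) (θ : UnitAddCircle) : Prop :=
  ∃ k : ℤ, rot α k (2 • θ) = 0

/-- The denominator `q_n` of the `n`-th continued fraction approximant `p_n / q_n` of `α`. -/
def q (α : ℝ) (n : ℕ) : ℕ := (α.convergent n).den

/-- `I(lam) = ∫ log |c_lam| dμ`. -/
def I (lam : Coupling) (α : ℝ) : ℝ :=
  ∫ x : UnitAddCircle, Real.log ‖c lam α x‖ ∂AddCircle.haarAddCircle

/-- `d^{(n)}(x) = ∏_{j=0}^{n-1} c_lam(x + jα)`. -/
def d (lam : Coupling) (α : ℝ) (n : ℕ) (x : UnitAddCircle) : ℂ :=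
  ∏ j ∈ Finset.range n, c lam α (rot α j x)

/-- `(q_{n_l})_l` is a subsequence of `(q_n)` along which
`(1/q) ∑_{j<q} log |c_lam(x + jα)| - ∫ log |c_lam| dμ ≤ C/q` uniformly in `x`.
The inequality is exponentiated, so that it is also correct (the left side being `-∞`)
where some factor vanishes. -/
def IsErgodicSubseq (lam : Coupling) (α : ℝ) (n : ℕ → ℕ) : Prop :=
  StrictMono n ∧ ∃ C : ℝ, ∀ (l : ℕ) (x : UnitAddCircle),
    ‖d lam α (q α (n l)) x‖ ≤ Real.exp (q α (n l) * I lam α + C)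

/-- The concatenation `(x_0, y_0, x_1, y_1, …)` of two sequences. -/
def concat (x y : ℕ → ℕ) (l : ℕ) : ℕ := if Even l then x (l / 2) else y (l / 2)

/-- The sequence `(m_l) = (q_{n_l}) ∪ (2 q_{n_l})`. -/
def m (α : ℝ) (n : ℕ → ℕ) : ℕ → ℕ :=
  concat (fun l => q α (n l)) (fun l => 2 * q α (n l))

/-- The duality map for zero nearest neighbour coupling: `(l1, 0, l3) ↦ (l3, 1, l1)`. -/
def dual (l1 l3 : ℝ) : Coupling := ⟨l3, 1, l1⟩

/-- The cocycle matrix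
`c(x)⁻¹ [[E, -conj c(x - α)], [c(x), 0]]`, which is defined wherever `c(x) ≠ 0`. -/
def B (lam : Coupling) (α E : ℝ) (x : UnitAddCircle) : Matrix (Fin 2) (Fin 2) ℂ :=
  (c lam α x)⁻¹ • !![(E : ℂ), -conj (c lam α (rot α (-1) x)); c lam α x, 0]

/-- The iterates `B_n(x) = B(x + (n-1)α) ⋯ B(x)`. -/
def iter (lam : Coupling) (α E : ℝ) : ℕ → UnitAddCircle → Matrix (Fin 2) (Fin 2) ℂ
  | 0, _ => 1
  | n + 1, x => B lam α E (rot α n x) * iter lam α E n x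

/-- The rotation `R_θ = diag(e^{2πiθ}, e^{-2πiθ})`. -/
def R (θ : UnitAddCircle) : Matrix (Fin 2) (Fin 2) ℂ :=
  !![fourier 1 θ, 0; 0, fourier (-1) θ]

/-- `Ψ^{(n)}(x) = tr { d^{(n)}(x) (B_n(x) - R_θ^n) }`. -/
def Psi (lam : Coupling) (α E : ℝ) (θ : UnitAddCircle) (n : ℕ) (x : UnitAddCircle) : ℂ :=
  (d lam α n x • (iter lam α E n x - R θ ^ n)).trace

/-- `e^{-n I} |Ψ̂^{(n)}(s n)|`, the normalised boundary Fourier coefficient of `Ψ^{(n)}`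
on the side `s = 1` or `s = -1`. -/
def boundaryCoeff (lam : Coupling) (α E : ℝ) (θ : UnitAddCircle) (s : ℤ) (n : ℕ) : ℝ :=
  Real.exp (-(n * I lam α)) * ‖fourierCoeff (Psi lam α E θ n) (s * n)‖

end

end EHM

namespace EHM

open MeasureTheory Filter
open scoped ComplexConjugate

/-! ### Sums over arithmetic progressions -/

@[to_additive]
theorem prod_range_eq_prod_zmod {X : Type*} [CommMonoid X] (Q : ℕ) [NeZero Q] (G : ZMod Q → X) :
    ∏ k ∈ Finset.range Q, G k = ∏ z : ZMod Q, G z := by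
  refine Finset.prod_nbij' (fun k => (k : ZMod Q)) ZMod.val (by simp) ?_ ?_ ?_ ?_
  · intro a _
    simpa using ZMod.val_lt a
  · intro a ha
    exact ZMod.val_cast_of_lt (by simpa using ha)
  · intro a _
    simp
  · simp

/-- A full period of a periodic function may be multiplied along any progression whose
difference is invertible modulo the period. -/
@[to_additive]
theorem prod_range_progression {X : Type*} [CommMonoid X] {Q : ℕ} (hQ : 0 < Q) {P : ℤ}
    (hP : IsCoprime P (Q : ℤ)) (a : ℤ) (F : ℤ → X) (hF : ∀ x y : ℤ, F (x + Q * y) = F x) :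
    ∏ k ∈ Finset.range Q, F (a + k * P) = ∏ k ∈ Finset.range Q, F k := by
  have : NeZero Q := ⟨hQ.ne'⟩
  let G : ZMod Q → X := fun z => F z.val
  have hG (x : ℤ) : F x = G (x : ZMod Q) := by
    have h : ((((x : ZMod Q).val : ℕ) : ℤ) : ZMod Q) = (x : ZMod Q) := by simp
    rw [ZMod.intCast_eq_intCast_iff_dvd_sub] at h
    obtain ⟨y, hy⟩ := h
    change F x = F _
    rw [← hF ((x : ZMod Q).val : ℤ) y, ← hy]
    congr 1
    ring
  have hu : IsUnit (P : ZMod Q) := by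
    obtain ⟨u, w, h⟩ := hP
    refine IsUnit.of_mul_eq_one (u : ZMod Q) ?_
    have := congrArg (fun n : ℤ => (n : ZMod Q)) h
    push_cast at this
    rw [ZMod.natCast_self, mul_zero, add_zero] at this
    rw [mul_comm, this]
  obtain ⟨u, hu⟩ := hu
  simp only [hG]
  push_cast
  rw [prod_range_eq_prod_zmod Q (fun z => G ((a : ZMod Q) + z * (P : ZMod Q))),
    prod_range_eq_prod_zmod Q G]
  refine Fintype.prod_equiv ((Units.mulRight u).trans (Equiv.addLeft (a : ZMod Q))) _ _ ?_
  intro x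
  simp [← hu]

theorem sum_fract_grid {Q : ℕ} (hQ : 0 < Q) {P : ℤ} (hP : IsCoprime P (Q : ℤ)) (s : ℝ) :
    ∑ k ∈ Finset.range Q, Int.fract (s + k * (P / Q)) = ((Q : ℝ) - 1) / 2 + Int.fract (s * Q) := by
  have hQ' : (0 : ℝ) < Q := by exact_mod_cast hQ
  set f := Int.fract (s * Q) with hf
  have hs : s = (⌊s * Q⌋ + f) / Q := by
    rw [hf, Int.floor_add_fract]
    field_simp
  have h1 := sum_range_progression hQ hP ⌊s * Q⌋ (fun x => Int.fract (((x : ℝ) + f) / Q)) (by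
    intro x y
    rw [← Int.fract_add_intCast ((x + f) / Q) y]
    congr 1
    push_cast
    field_simp
    ring)
  have h2 : ∀ k ∈ Finset.range Q, Int.fract ((((k : ℤ) : ℝ) + f) / Q) = (k + f) / Q := by
    intro k hk
    have hk' : (k : ℝ) + 1 ≤ Q := by exact_mod_cast Finset.mem_range.mp hk
    have := Int.fract_nonneg (s * Q)
    have := Int.fract_lt_one (s * Q)
    rw [Int.cast_natCast, Int.fract_eq_self]
    constructor
    · positivity
    · rw [div_lt_one hQ']
      linarith
  have h3 : ∀ k : ℕ, s + k * (P / Q) = ((((⌊s * Q⌋ + k * P : ℤ) : ℝ)) + f) / Q := by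
    intro k
    push_cast
    conv_lhs => rw [hs]
    ring
  simp only [h3]
  rw [h1, Finset.sum_congr rfl h2, ← Finset.sum_div, Finset.sum_add_distrib, Finset.sum_const,
    Finset.card_range, nsmul_eq_mul]
  have h4 : ∑ k ∈ Finset.range Q, (k : ℝ) = Q * (Q - 1) / 2 := by
    clear * -
    induction Q with
    | zero => simp
    | succ n ih => rw [Finset.sum_range_succ, ih]; push_cast; ring
  rw [h4]
  field_simp

/-! ### Discrepancy of the sawtooth function along a rotation -/

theorem fract_le_fract_add {x y e : ℝ} (h : x ≤ y) (he : y - x ≤ e) :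
    Int.fract y ≤ Int.fract x + e := by
  have h1 := Int.fract_add_le x (y - x)
  rw [add_sub_cancel] at h1
  have h2 : Int.fract (y - x) ≤ y - x := by
    have := Int.floor_nonneg.mpr (sub_nonneg.mpr h)
    have h3 : (0 : ℝ) ≤ ⌊y - x⌋ := by exact_mod_cast this
    rw [Int.fract]
    linarith
  linarith

/-- Over one period of a good rational approximation the centred fractional parts almost
cancel. -/
theorem abs_sum_fract_block_le {Q : ℕ} (hQ : 0 < Q) {P : ℤ} (hP : IsCoprime P (Q : ℤ)) {β : ℝ}
    (hβ : |β - P / Q| ≤ 1 / (Q : ℝ) ^ 2) (t : ℝ) :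
    |∑ k ∈ Finset.range Q, (Int.fract (t + k * β) - 1 / 2)| ≤ 3 := by
  have hQ' : (0 : ℝ) < Q := by exact_mod_cast hQ
  have key (k : ℕ) (hk : k ∈ Finset.range Q) : |k * (β - P / Q)| ≤ 1 / Q := by
    have hk' : (k : ℝ) ≤ Q := by exact_mod_cast (Finset.mem_range.mp hk).le
    rw [abs_mul, abs_of_nonneg (by positivity : (0 : ℝ) ≤ k)]
    calc (k : ℝ) * |β - P / Q| ≤ Q * (1 / (Q : ℝ) ^ 2) := by gcongr
      _ = 1 / Q := by field_simp
  have hc : ∑ k ∈ Finset.range Q, (2 / (Q : ℝ)) = 2 := by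
    rw [Finset.sum_const, Finset.card_range, nsmul_eq_mul]
    field_simp
  have hu : ∑ k ∈ Finset.range Q, Int.fract (t + k * β) ≤
      ∑ k ∈ Finset.range Q, (Int.fract ((t - 1 / Q) + k * (P / Q)) + 2 / Q) := by
    refine Finset.sum_le_sum fun k hk => ?_
    have := abs_le.mp (key k hk)
    have e : (t + k * β) - ((t - 1 / Q) + k * (P / Q)) = k * (β - P / Q) + 1 / Q := by ring
    have e2 : (2 : ℝ) / Q = 1 / Q + 1 / Q := by ring
    apply fract_le_fract_add <;> linarith
  have hl : ∑ k ∈ Finset.range Q, Int.fract ((t + 1 / Q) + k * (P / Q)) ≤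
      ∑ k ∈ Finset.range Q, (Int.fract (t + k * β) + 2 / Q) := by
    refine Finset.sum_le_sum fun k hk => ?_
    have := abs_le.mp (key k hk)
    have e : ((t + 1 / Q) + k * (P / Q)) - (t + k * β) = 1 / Q - k * (β - P / Q) := by ring
    have e2 : (2 : ℝ) / Q = 1 / Q + 1 / Q := by ring
    apply fract_le_fract_add <;> linarith
  rw [Finset.sum_add_distrib, hc] at hu hl
  rw [sum_fract_grid hQ hP] at hu hl
  have := Int.fract_lt_one ((t - 1 / Q) * Q)
  have := Int.fract_nonneg ((t + 1 / Q) * Q)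
  rw [Finset.sum_sub_distrib, Finset.sum_const, Finset.card_range, nsmul_eq_mul, abs_le]
  constructor <;> linarith

theorem abs_fract_sub_half_le (x : ℝ) : |Int.fract x - 1 / 2| ≤ 1 / 2 := by
  rw [abs_le]
  have := Int.fract_lt_one x
  have := Int.fract_nonneg x
  constructor <;> linarith

theorem abs_sum_fract_blocks_le {Q : ℕ} {β A : ℝ}
    (h : ∀ t : ℝ, |∑ k ∈ Finset.range Q, (Int.fract (t + k * β) - 1 / 2)| ≤ A) (a b : ℕ) (t : ℝ) :
    |∑ k ∈ Finset.range (a * Q + b), (Int.fract (t + k * β) - 1 / 2)| ≤ a * A + b / 2 := by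
  induction a generalizing t with
  | zero =>
    rw [zero_mul, zero_add]
    refine (Finset.abs_sum_le_sum_abs _ _).trans ?_
    refine (Finset.sum_le_sum fun k _ => abs_fract_sub_half_le _).trans ?_
    rw [Finset.sum_const, Finset.card_range, nsmul_eq_mul]
    push_cast
    linarith
  | succ a ih =>
    rw [show (a + 1) * Q + b = Q + (a * Q + b) by ring, Finset.sum_range_add]
    refine (abs_add_le _ _).trans ?_
    have h1 := ih (t + Q * β)
    have h2 : ∀ k : ℕ, t + ((Q + k : ℕ) : ℝ) * β = t + Q * β + k * β := by
      intro k
      push_cast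
      ring
    simp only [h2]
    push_cast
    linarith [h t]

theorem abs_sum_fract_le {β K : ℝ} (hK : 1 ≤ K) {N : ℕ} (hN : 0 < N)
    (h : ∀ Q : ℕ, 0 < Q → Q ≤ Nat.sqrt N → ∀ P : ℤ, 1 ≤ K * (Q * |Q * β - P|)) (t : ℝ) :
    |∑ k ∈ Finset.range N, (Int.fract (t + k * β) - 1 / 2)| ≤ 4 * K * √N := by
  have hs : 0 < Nat.sqrt N := Nat.sqrt_pos.mpr hN
  obtain ⟨r, hr, hrd⟩ := Real.exists_rat_abs_sub_le_and_den_le β hs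
  have hQ := r.den_pos
  set Q := r.den with hQdef
  have hQ' : (0 : ℝ) < Q := by exact_mod_cast hQ
  have hr' : |β - r.num / Q| ≤ 1 / ((Nat.sqrt N + 1) * Q) := by
    have : (r : ℝ) = r.num / Q := by rw [hQdef]; exact Rat.cast_def r
    rwa [← this]
  have hsq : (Q : ℝ) ≤ Nat.sqrt N := by exact_mod_cast hrd
  have hblock := abs_sum_fract_block_le hQ (P := r.num)
    (by rw [Int.isCoprime_iff_gcd_eq_one]; exact r.reduced) (β := β) (hr'.trans (by
      apply one_div_le_one_div_of_le (by positivity)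
      nlinarith))
  have hbl := abs_sum_fract_blocks_le hblock (N / Q) (N % Q) t
  rw [Nat.div_add_mod'] at hbl
  have h1 := h Q hQ hrd r.num
  have h2 : |Q * β - r.num| ≤ 1 / (Nat.sqrt N + 1) := by
    have : Q * β - r.num = Q * (β - r.num / Q) := by field_simp
    rw [this, abs_mul, abs_of_pos hQ']
    calc Q * |β - r.num / Q| ≤ Q * (1 / ((Nat.sqrt N + 1) * Q)) := by gcongr
      _ = _ := by field_simp
  have h3 : ((Nat.sqrt N : ℝ) + 1) ≤ K * Q := by
    have : 1 ≤ K * (Q * (1 / ((Nat.sqrt N : ℝ) + 1))) := h1.trans (by gcongr)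
    have e : K * (Q * (1 / ((Nat.sqrt N : ℝ) + 1))) = K * Q / (Nat.sqrt N + 1) := by ring
    rw [e, le_div_iff₀ (by positivity)] at this
    linarith
  have h4 : √N ≤ Nat.sqrt N + 1 := by
    rw [Real.sqrt_le_left (by positivity)]
    exact_mod_cast (Nat.lt_succ_sqrt' N).le
  have h5 : (Nat.sqrt N : ℝ) ≤ √N := Real.nat_sqrt_le_real_sqrt
  have h6 : ((N / Q : ℕ) : ℝ) ≤ K * √N := by
    refine Nat.cast_div_le.trans ?_
    rw [div_le_iff₀ hQ']
    have h7 : √N ≤ K * Q := h4.trans h3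
    have := Real.mul_self_sqrt (Nat.cast_nonneg (α := ℝ) N)
    nlinarith [Real.sqrt_nonneg (N : ℝ)]
  have h7 : ((N % Q : ℕ) : ℝ) ≤ √N := by
    have : ((N % Q : ℕ) : ℝ) ≤ Q := by exact_mod_cast (Nat.mod_lt N hQ).le
    linarith
  have h8 : √N ≤ K * √N := le_mul_of_one_le_left (Real.sqrt_nonneg _) hK
  refine hbl.trans ?_
  have := Real.sqrt_nonneg (N : ℝ)
  linarith

/-! ### The exponential `e(x) = e^{2πix}` -/

/-- `e(x) = e^{2πix}`. -/
noncomputable def e (x : ℝ) : ℂ := Complex.exp (Complex.I * ((2 * Real.pi * x : ℝ) : ℂ))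

theorem e_add (x y : ℝ) : e (x + y) = e x * e y := by
  rw [e, e, e, ← Complex.exp_add]
  push_cast
  ring_nf

theorem e_zero : e 0 = 1 := by simp [e]

theorem norm_e (x : ℝ) : ‖e x‖ = 1 := by
  rw [e, mul_comm, Complex.norm_exp_ofReal_mul_I]

theorem conj_e (x : ℝ) : conj (e x) = e (-x) := by
  rw [e, e, ← Complex.exp_conj, map_mul, Complex.conj_I, Complex.conj_ofReal]
  push_cast
  ring_nf

theorem e_int (n : ℤ) : e n = 1 := by
  rw [e, ← Complex.exp_int_mul_two_pi_mul_I n]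
  push_cast
  ring_nf

theorem e_add_int (x : ℝ) (n : ℤ) : e (x + n) = e x := by
  rw [e_add, e_int, mul_one]

theorem norm_e_sub_one (x : ℝ) : ‖e x - 1‖ = 2 * |Real.sin (Real.pi * x)| := by
  rw [e, Complex.norm_exp_I_mul_ofReal_sub_one, norm_mul, Real.norm_eq_abs, Real.norm_eq_abs]
  norm_num
  ring_nf

theorem norm_e_sub_one_le (x : ℝ) : ‖e x - 1‖ ≤ 2 * Real.pi * |x| := by
  rw [e]
  refine Real.norm_exp_I_mul_ofReal_sub_one_le.trans ?_
  rw [Real.norm_eq_abs, abs_mul, abs_of_pos Real.two_pi_pos]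

theorem norm_e_sub_e_le (x y : ℝ) : ‖e x - e y‖ ≤ 2 * Real.pi * |x - y| := by
  have h : e x - e y = e y * (e (x - y) - 1) := by
    rw [mul_sub, ← e_add]
    ring_nf
  rw [h, norm_mul, norm_e, one_mul]
  exact norm_e_sub_one_le _

theorem norm_e_sub_one_sub_le (x : ℝ) :
    ‖e x - 1 - Complex.I * ((2 * Real.pi * x : ℝ) : ℂ)‖ ≤ 2 * (2 * Real.pi * |x|) ^ 2 := by
  have hn : ‖Complex.I * ((2 * Real.pi * x : ℝ) : ℂ)‖ = 2 * Real.pi * |x| := by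
    rw [norm_mul, Complex.norm_I, one_mul, Complex.norm_real, Real.norm_eq_abs, abs_mul,
      abs_of_pos Real.two_pi_pos]
  have h0 : 0 ≤ 2 * Real.pi * |x| := by positivity
  rcases le_total (2 * Real.pi * |x|) 1 with h | h
  · refine (Complex.norm_exp_sub_one_sub_id_le (hn.le.trans h)).trans ?_
    rw [hn]
    nlinarith
  · refine (norm_sub_le _ _).trans ?_
    rw [hn]
    nlinarith [norm_e_sub_one_le x]

theorem abs_le_norm_e_sub_one {x : ℝ} (hx : |x| ≤ 3 / 4) : |x| ≤ ‖e x - 1‖ := by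
  rw [norm_e_sub_one]
  have h1 : |Real.sin (Real.pi * x)| = |Real.sin (Real.pi * |x|)| := by
    rcases abs_choice x with h | h <;> rw [h]
    rw [mul_neg, Real.sin_neg, abs_neg]
  rw [h1]
  have hp := Real.pi_pos
  have h0 := abs_nonneg x
  set y := |x|
  have h2 := le_abs_self (Real.sin (Real.pi * y))
  rcases le_total y (1 / 2) with h | h
  · have := Real.mul_le_sin (x := Real.pi * y) (by positivity) (by nlinarith)
    have e1 : 2 / Real.pi * (Real.pi * y) = 2 * y := by field_simp
    linarith
  · have := Real.mul_le_sin (x := Real.pi * (1 - y)) (by nlinarith) (by nlinarith)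
    have e1 : 2 / Real.pi * (Real.pi * (1 - y)) = 2 * (1 - y) := by field_simp
    have e2 : Real.sin (Real.pi * (1 - y)) = Real.sin (Real.pi * y) := by
      rw [mul_sub, mul_one, Real.sin_pi_sub]
    linarith

theorem exists_eq_norm_mul_e (z : ℂ) : ∃ s : ℝ, z = ‖z‖ * e s := by
  refine ⟨z.arg / (2 * Real.pi), ?_⟩
  have := Real.pi_ne_zero
  conv_lhs => rw [← Complex.norm_mul_exp_arg_mul_I z]
  rw [e, mul_comm (z.arg : ℂ)]
  congr 4
  field_simp

theorem norm_sub_one_le_norm_mul_sub_one {R : ℝ} (hR : 1 ≤ R) {u : ℂ} (hu : ‖u‖ = 1) :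
    ‖u - 1‖ ≤ ‖R * u - 1‖ := by
  have h1 : Complex.normSq u = 1 := by rw [Complex.normSq_eq_norm_sq, hu, one_pow]
  have h2 : u.re ≤ 1 := (Complex.re_le_norm u).trans hu.le
  rw [Complex.normSq_apply] at h1
  apply le_of_sq_le_sq _ (norm_nonneg _)
  rw [← Complex.normSq_eq_norm_sq, ← Complex.normSq_eq_norm_sq, Complex.normSq_apply,
    Complex.normSq_apply]
  simp only [Complex.sub_re, Complex.sub_im, Complex.re_ofReal_mul, Complex.im_ofReal_mul,
    Complex.one_re, Complex.one_im]
  have h3 : (R * u.re - 1) * (R * u.re - 1) + (R * u.im - 0) * (R * u.im - 0) =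
      R ^ 2 * (u.re * u.re + u.im * u.im) - 2 * R * u.re + 1 := by ring
  rw [h3, h1]
  nlinarith [mul_nonneg (sub_nonneg.mpr hR) (sub_nonneg.mpr h2)]

theorem norm_one_add_le_exp (ξ : ℂ) : ‖1 + ξ‖ ≤ Real.exp (ξ.re + ‖ξ‖ ^ 2 / 2) := by
  apply le_of_sq_le_sq _ (Real.exp_pos _).le
  rw [← Real.exp_nat_mul, ← Complex.normSq_eq_norm_sq, ← Complex.normSq_eq_norm_sq]
  refine le_trans (le_of_eq ?_) (Real.add_one_le_exp _)
  rw [Complex.normSq_apply, Complex.normSq_apply]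
  simp only [Complex.add_re, Complex.add_im, Complex.one_re, Complex.one_im]
  push_cast
  ring

theorem prod_sub_e_div {q : ℕ} (hq : 0 < q) (z : ℂ) :
    ∏ k ∈ Finset.range q, (z - e (k / q)) = z ^ q - 1 := by
  have : NeZero q := ⟨hq.ne'⟩
  have hp := Complex.isPrimitiveRoot_exp q hq.ne'
  have h := hp.pow_sub_pow_eq_prod_sub_mul z 1 hq
  rw [one_pow] at h
  rw [h]
  have hk (k : ℕ) : e (k / q) = Complex.exp (2 * Real.pi * Complex.I / q) ^ k := by
    rw [e, ← Complex.exp_nat_mul]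
    congr 1
    push_cast
    ring
  refine Finset.prod_nbij (fun k => e (k / q)) ?_ ?_ ?_ ?_
  · intro k _
    rw [Polynomial.mem_nthRootsFinset hq, hk, pow_right_comm, hp.pow_eq_one, one_pow]
  · intro a ha b hb hab
    simp only [hk] at hab
    exact hp.pow_inj (by simpa using ha) (by simpa using hb) hab
  · intro x hx
    obtain ⟨k, hk1, hk2⟩ := hp.eq_pow_of_pow_eq_one
      ((Polynomial.mem_nthRootsFinset hq _).mp (by simpa using hx))
    exact ⟨k, by simpa using hk1, by simp only [hk, hk2]⟩
  · intro k _
    rw [mul_one]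

/-! ### Summation by parts -/

theorem sum_sqrt_div_sq_le (n : ℕ) :
    ∑ i ∈ Finset.range n, √((i : ℝ) + 1) / ((i : ℝ) + 1) ^ 2 ≤ 3 := by
  suffices h : ∀ n : ℕ, ∑ i ∈ Finset.range (n + 1), √((i : ℝ) + 1) / ((i : ℝ) + 1) ^ 2 ≤
      3 - 2 / √((n : ℝ) + 1) by
    rcases n with _ | n
    · simp
    · have : 0 ≤ 2 / √((n : ℝ) + 1) := by positivity
      linarith [h n]
  intro n
  induction n with
  | zero => norm_num
  | succ n ih =>
    rw [Finset.sum_range_succ]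
    push_cast
    set a := √((n : ℝ) + 1) with ha
    set b := √((n : ℝ) + 1 + 1) with hb
    have ha0 : 0 < a := by positivity
    have hb0 : 0 < b := by positivity
    have ha2 : a ^ 2 = n + 1 := Real.sq_sqrt (by positivity)
    have hb2 : b ^ 2 = n + 1 + 1 := Real.sq_sqrt (by positivity)
    have hab : a ≤ b := Real.sqrt_le_sqrt (by linarith)
    have key : b / ((n : ℝ) + 1 + 1) ^ 2 ≤ 2 / a - 2 / b := by
      rw [← hb2, div_sub_div _ _ ha0.ne' hb0.ne', div_le_div_iff₀ (by positivity) (by positivity)]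
      have h1 : (2 * b - a * 2) * (b + a) = 2 := by
        have : (2 * b - a * 2) * (b + a) = 2 * (b ^ 2 - a ^ 2) := by ring
        rw [this, ha2, hb2]
        ring
      have h2 : 0 < b + a := by positivity
      have h3 : b * (a * b) * (b + a) ≤ (2 * b - 2 * a) * (b ^ 2) ^ 2 * (b + a) := by
        have : (2 * b - 2 * a) * (b ^ 2) ^ 2 * (b + a) =
          ((2 * b - a * 2) * (b + a)) * (b ^ 2) ^ 2 := by ring
        rw [this, h1]
        have h4 : a * (b + a) ≤ 2 * b ^ 2 := by nlinarith
        calc b * (a * b) * (b + a) = b ^ 2 * (a * (b + a)) := by ring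
          _ ≤ b ^ 2 * (2 * b ^ 2) := by gcongr
          _ = _ := by ring
      have h5 := le_of_mul_le_mul_right h3 h2
      linarith
    linarith

theorem sum_inv_sq_le (n : ℕ) : ∑ i ∈ Finset.range n, 1 / ((i : ℝ) + 1) ^ 2 ≤ 3 := by
  refine (Finset.sum_le_sum fun i _ => ?_).trans (sum_sqrt_div_sq_le n)
  gcongr
  rw [Real.one_le_sqrt]
  linarith [Nat.cast_nonneg (α := ℝ) i]

/-- Summation by parts against a weight decaying like `1 / h`. -/
theorem norm_sum_smul_le_of_discrepancy {b : ℕ → ℝ} {g : ℕ → ℂ} {A M : ℝ} (hA : 0 ≤ A)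
    (hM : 0 ≤ M) {N : ℕ}
    (hb : ∀ n, 0 < n → n ≤ N → |∑ h ∈ Finset.range n, b h| ≤ A * √n)
    (hg : ∀ h, h < N → ‖g h‖ ≤ M / (h + 1))
    (hd : ∀ h, h + 1 < N → ‖g h - g (h + 1)‖ ≤ M / ((h : ℝ) + 1) ^ 2) :
    ‖∑ h ∈ Finset.range N, b h * g h‖ ≤ 4 * A * M := by
  rcases N with _ | N
  · simpa using by positivity
  have h := Finset.sum_range_by_parts g (fun h => (b h : ℂ)) (N + 1)
  simp only [smul_eq_mul, Nat.add_sub_cancel] at h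
  have h' : ∑ h ∈ Finset.range (N + 1), b h * g h = ∑ h ∈ Finset.range (N + 1), g h * b h :=
    Finset.sum_congr rfl fun _ _ => mul_comm _ _
  rw [h', h]
  have hB (n : ℕ) (h0 : 0 < n) (h1 : n ≤ N + 1) :
      ‖∑ i ∈ Finset.range n, (b i : ℂ)‖ ≤ A * √n := by
    rw [← Complex.ofReal_sum, Complex.norm_real, Real.norm_eq_abs]
    exact hb n h0 h1
  refine (norm_sub_le _ _).trans ?_
  have e1 : ‖g N * ∑ i ∈ Finset.range (N + 1), (b i : ℂ)‖ ≤ A * M := by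
    rw [norm_mul]
    calc _ ≤ M / (N + 1) * (A * √((N + 1 : ℕ) : ℝ)) := by
          gcongr
          · exact hg N (by omega)
          · exact hB _ (by omega) le_rfl
      _ ≤ M / (N + 1) * (A * (N + 1)) := by
          gcongr
          rw [Real.sqrt_le_left (by positivity)]
          push_cast
          nlinarith [Nat.cast_nonneg (α := ℝ) N]
      _ = A * M := by field_simp
  have e2 : ‖∑ i ∈ Finset.range N, (g (i + 1) - g i) * ∑ j ∈ Finset.range (i + 1), (b j : ℂ)‖ ≤
      A * M * 3 := by
    refine (norm_sum_le _ _).trans ?_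
    calc _ ≤ ∑ i ∈ Finset.range N, A * M * (√((i : ℝ) + 1) / ((i : ℝ) + 1) ^ 2) := by
          refine Finset.sum_le_sum fun i hi => ?_
          have hi' := Finset.mem_range.mp hi
          rw [norm_mul, norm_sub_rev]
          calc _ ≤ M / ((i : ℝ) + 1) ^ 2 * (A * √((i + 1 : ℕ) : ℝ)) := by
                gcongr
                · exact hd i (by omega)
                · exact hB _ (by omega) (by omega)
            _ = _ := by push_cast; ring
      _ ≤ _ := by
          rw [← Finset.mul_sum]
          gcongr
          exact sum_sqrt_div_sq_le N
  linarith

/-! ### Sums over the `q`-th roots of unity against the Cauchy kernel -/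

theorem sum_range_eq_two_sided {X : Type*} [AddCommMonoid X] {q : ℕ} (hq : 0 < q) (F : ℤ → X)
    (hF : ∀ x y : ℤ, F (x + q * y) = F x) (k₀ : ℤ) :
    ∑ k ∈ Finset.range q, F k = ∑ i ∈ Finset.range (q / 2), F (k₀ - i) +
      ∑ i ∈ Finset.range (q - q / 2), F (k₀ + 1 + i) := by
  rw [← sum_range_progression hq isCoprime_one_left (k₀ + 1 - (q / 2 : ℕ)) F hF]
  conv_lhs => rw [show q = q / 2 + (q - q / 2) by omega]
  rw [Finset.sum_range_add]
  congr 1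
  · rw [← Finset.sum_range_reflect]
    refine Finset.sum_congr rfl fun i hi => ?_
    have := Finset.mem_range.mp hi
    congr 1
    omega
  · refine Finset.sum_congr rfl fun i hi => ?_
    congr 1
    push_cast
    omega

theorem norm_sub_e_ge_sub_one (z : ℂ) (y : ℝ) : ‖z‖ - 1 ≤ ‖z - e y‖ := by
  have := norm_sub_norm_le z (e y)
  rwa [norm_e] at this

theorem abs_le_norm_mul_e_sub_e {R : ℝ} (hR : 1 ≤ R) {s y : ℝ} (h : |s - y| ≤ 3 / 4) :
    |s - y| ≤ ‖R * e s - e y‖ := by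
  have h1 : (R : ℂ) * e s - e y = e y * (R * e (s - y) - 1) := by
    rw [mul_sub, mul_left_comm, ← e_add]
    ring_nf
  rw [h1, norm_mul, norm_e, one_mul]
  exact (abs_le_norm_e_sub_one h).trans (norm_sub_one_le_norm_mul_sub_one hR (norm_e _))

/-- The distance from a point on the circle of radius `1 + 1 / q` to the root of unity which
lies `h` steps away. -/
theorem le_norm_mul_e_sub_e_div {q : ℕ} (hq : 0 < q) {s : ℝ} {x : ℤ} {h : ℕ}
    (h1 : (h : ℝ) ≤ |s * q - x|) (h2 : |s * q - x| ≤ h + 1) (h3 : h + 1 ≤ q - q / 2) :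
    ((h : ℝ) + 1) / (2 * q) ≤ ‖((1 + 1 / q : ℝ) : ℂ) * e s - e (x / q)‖ := by
  have hq' : (0 : ℝ) < q := by exact_mod_cast hq
  have hR : (1 : ℝ) ≤ 1 + 1 / q := by
    have : (0 : ℝ) ≤ 1 / q := by positivity
    linarith
  rcases Nat.eq_zero_or_pos h with rfl | h0
  · refine le_trans ?_ (norm_sub_e_ge_sub_one _ _)
    rw [norm_mul, norm_e, Complex.norm_real, Real.norm_eq_abs, abs_of_pos (by positivity), mul_one,
      add_sub_cancel_left]
    push_cast
    rw [zero_add]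
    apply one_div_le_one_div_of_le hq'
    linarith
  · have h0' : (1 : ℝ) ≤ h := by exact_mod_cast h0
    have e1 : |s - x / q| = |s * q - x| / q := by
      rw [← abs_of_pos hq', ← abs_div, abs_of_pos hq']
      congr 1
      field_simp
    have h4 : 2 * (h + 1 : ℕ) ≤ (q + 1 : ℕ) := by omega
    have h5 : 2 * ((h : ℝ) + 1) ≤ q + 1 := by exact_mod_cast h4
    refine le_trans ?_ (abs_le_norm_mul_e_sub_e hR ?_)
    · rw [e1, div_le_div_iff₀ (by positivity) hq']
      nlinarith
    · rw [e1, div_le_iff₀ hq']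
      linarith

/-- The two-sided enumeration of the roots of unity by distance from a given point. -/
theorem le_norm_mul_e_sub_e_div_two_sided {q : ℕ} (hq : 0 < q) (s : ℝ) :
    (∀ h : ℕ, h < q / 2 → ((h : ℝ) + 1) / (2 * q) ≤
      ‖((1 + 1 / q : ℝ) : ℂ) * e s - e ((⌊s * q⌋ - h : ℤ) / q)‖) ∧
    (∀ h : ℕ, h < q - q / 2 → ((h : ℝ) + 1) / (2 * q) ≤
      ‖((1 + 1 / q : ℝ) : ℂ) * e s - e ((⌊s * q⌋ + 1 + h : ℤ) / q)‖) := by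
  have hf := Int.floor_le (s * q)
  have hf' := Int.lt_floor_add_one (s * q)
  have hh (h : ℕ) : (0 : ℝ) ≤ h := Nat.cast_nonneg h
  constructor
  · intro h hlt
    have e1 : |s * q - ((⌊s * q⌋ - h : ℤ) : ℝ)| = s * q - ⌊s * q⌋ + h := by
      rw [abs_of_nonneg] <;> push_cast <;> linarith [hh h]
    apply le_norm_mul_e_sub_e_div hq <;> first | omega | (rw [e1]; linarith)
  · intro h hlt
    have e1 : |s * q - ((⌊s * q⌋ + 1 + h : ℤ) : ℝ)| = ⌊s * q⌋ + 1 + h - s * q := by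
      rw [abs_of_nonpos] <;> push_cast <;> linarith [hh h]
    apply le_norm_mul_e_sub_e_div hq <;> first | omega | (rw [e1]; linarith)

theorem e_div_periodic {q : ℕ} (hq : 0 < q) (x y : ℤ) :
    e (((x + q * y : ℤ) : ℝ) / q) = e (x / q) := by
  have hq' : (q : ℝ) ≠ 0 := by exact_mod_cast hq.ne'
  rw [← e_add_int (x / q) y]
  congr 1
  push_cast
  field_simp

theorem sum_inv_norm_sq_le {q : ℕ} (hq : 0 < q) (s : ℝ) :
    ∑ k ∈ Finset.range q, (‖((1 + 1 / q : ℝ) : ℂ) * e s - e ((k : ℤ) / q)‖ ^ 2)⁻¹ ≤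
      24 * (q : ℝ) ^ 2 := by
  have hq' : (0 : ℝ) < q := by exact_mod_cast hq
  rw [sum_range_eq_two_sided hq
    (fun x => (‖((1 + 1 / q : ℝ) : ℂ) * e s - e ((x : ℤ) / q)‖ ^ 2)⁻¹)
    (fun x y => by simp only [e_div_periodic hq]) ⌊s * q⌋]
  obtain ⟨h1, h2⟩ := le_norm_mul_e_sub_e_div_two_sided hq s
  have key (N : ℕ) (G : ℕ → ℝ) (hG : ∀ h < N, ((h : ℝ) + 1) / (2 * q) ≤ G h) :
      ∑ h ∈ Finset.range N, (G h ^ 2)⁻¹ ≤ 12 * (q : ℝ) ^ 2 := by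
    calc ∑ h ∈ Finset.range N, (G h ^ 2)⁻¹
        ≤ ∑ h ∈ Finset.range N, 4 * (q : ℝ) ^ 2 * (1 / ((h : ℝ) + 1) ^ 2) := by
          refine Finset.sum_le_sum fun h hh => ?_
          have e1 : 4 * (q : ℝ) ^ 2 * (1 / ((h : ℝ) + 1) ^ 2) =
              ((((h : ℝ) + 1) / (2 * q)) ^ 2)⁻¹ := by
            field_simp
            norm_num
          rw [e1]
          gcongr
          exact hG h (Finset.mem_range.mp hh)
      _ ≤ 4 * (q : ℝ) ^ 2 * 3 := by
          rw [← Finset.mul_sum]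
          gcongr
          exact sum_inv_sq_le N
      _ = _ := by ring
  have := key _ _ h1
  have := key _ _ h2
  linarith

theorem norm_kernel_le {z w : ℂ} (hw : ‖w‖ = 1) {a : ℝ} (ha : 0 < a) (h : a ≤ ‖z - w‖) :
    ‖w / (z - w)‖ ≤ 1 / a := by
  rw [norm_div, hw]
  exact one_div_le_one_div_of_le ha h

theorem norm_kernel_sub_kernel {z w w' : ℂ} (h : z - w ≠ 0) (h' : z - w' ≠ 0) :
    ‖w / (z - w) - w' / (z - w')‖ = ‖z‖ * ‖w - w'‖ / (‖z - w‖ * ‖z - w'‖) := by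
  rw [← norm_mul, ← norm_mul, ← norm_div]
  congr 1
  field_simp
  ring

/-- One half of the sum over the roots of unity, in order of the distance from `z`. -/
theorem norm_half_sum_fract_mul_kernel_le {q : ℕ} (hq : 0 < q) {β K : ℝ} (hK : 1 ≤ K)
    {N : ℕ} (hN : N ≤ q)
    (hβ : ∀ Q : ℕ, 0 < Q → Q ≤ Nat.sqrt q → ∀ P : ℤ, 1 ≤ K * (Q * |Q * β - P|)) (t : ℝ)
    {z : ℂ} (hz : ‖z‖ ≤ 2) {y : ℕ → ℝ} (hy : ∀ h, |y h - y (h + 1)| = 1 / q)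
    (hg : ∀ h : ℕ, h < N → ((h : ℝ) + 1) / (2 * q) ≤ ‖z - e (y h)‖) :
    ‖∑ h ∈ Finset.range N,
      ((Int.fract (t + h * β) - 1 / 2 : ℝ) : ℂ) * (e (y h) / (z - e (y h)))‖
      ≤ 256 * Real.pi * K * q := by
  have hq' : (0 : ℝ) < q := by exact_mod_cast hq
  have hp := Real.pi_gt_three
  have hpos (h : ℕ) : 0 < ((h : ℝ) + 1) / (2 * q) := by positivity
  have hne (h : ℕ) (hh : h < N) : z - e (y h) ≠ 0 :=
    norm_pos_iff.mp ((hpos h).trans_le (hg h hh))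
  have := norm_sum_smul_le_of_discrepancy (b := fun h => Int.fract (t + h * β) - 1 / 2)
    (g := fun h => e (y h) / (z - e (y h))) (A := 4 * K) (M := 16 * Real.pi * q) (N := N)
    (by positivity) (by positivity)
    (fun n h0 hn => abs_sum_fract_le hK h0
      (fun Q hQ hQn P => hβ Q hQ (hQn.trans (Nat.sqrt_le_sqrt (hn.trans hN))) P) t)
    (fun h hh => by
      refine (norm_kernel_le (norm_e _) (hpos h) (hg h hh)).trans ?_
      rw [one_div_div]
      gcongr
      linarith)
    (fun h hh => by
      rw [norm_kernel_sub_kernel (hne h (by omega)) (hne _ hh)]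
      have h1 := norm_e_sub_e_le (y h) (y (h + 1))
      rw [hy] at h1
      have h2 := hg h (by omega)
      have h3 := hg (h + 1) hh
      have h4 : ((h : ℝ) + 1) / (2 * q) ≤ (((h + 1 : ℕ) : ℝ) + 1) / (2 * q) := by
        push_cast
        gcongr
        linarith
      calc _ ≤ 2 * (2 * Real.pi * (1 / q)) /
            (((h : ℝ) + 1) / (2 * q) * (((h : ℝ) + 1) / (2 * q))) := by
            gcongr
            exact h4.trans h3
        _ = _ := by
            field_simp
            norm_num)
  refine this.trans (le_of_eq ?_)
  ring

theorem norm_sum_fract_mul_kernel_le {q : ℕ} (hq : 0 < q) {p : ℤ} {K : ℝ} (hK : 1 ≤ K)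
    (hβ : ∀ Q : ℕ, 0 < Q → Q ≤ Nat.sqrt q → ∀ P : ℤ, 1 ≤ K * (Q * |Q * (p / q : ℝ) - P|))
    {z : ℂ} (hz : ‖z‖ = 1 + 1 / q) :
    ‖∑ k ∈ Finset.range q, ((Int.fract (((k : ℤ) : ℝ) * (p / q)) - 1 / 2 : ℝ) : ℂ) *
      (e ((k : ℤ) / q) / (z - e ((k : ℤ) / q)))‖ ≤ 512 * Real.pi * K * q := by
  have hq' : (0 : ℝ) < q := by exact_mod_cast hq
  have hq1 : (1 : ℝ) ≤ q := by exact_mod_cast hq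
  obtain ⟨s, hs⟩ := exists_eq_norm_mul_e z
  have hz2 : ‖z‖ ≤ 2 := by
    have : 1 / (q : ℝ) ≤ 1 := by
      rw [div_le_one hq']
      exact hq1
    linarith
  rw [hz] at hs
  obtain ⟨h1, h2⟩ := le_norm_mul_e_sub_e_div_two_sided hq s
  rw [← hs] at h1 h2
  rw [sum_range_eq_two_sided hq (fun x => ((Int.fract ((x : ℝ) * (p / q)) - 1 / 2 : ℝ) : ℂ) *
      (e (x / q) / (z - e (x / q)))) (fun x y => by
        simp only [e_div_periodic hq]
        have e1 : (((x + q * y : ℤ) : ℝ) * (p / q)) = x * (p / q) + (y * p : ℤ) := by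
          push_cast
          field_simp
        rw [e1, Int.fract_add_intCast]) ⌊s * q⌋]
  refine (norm_add_le _ _).trans ?_
  have hneg : ∀ Q : ℕ, 0 < Q → Q ≤ Nat.sqrt q → ∀ P : ℤ,
      1 ≤ K * (Q * |Q * (-(p / q : ℝ)) - P|) := by
    intro Q hQ hQ' P
    have := hβ Q hQ hQ' (-P)
    rw [← abs_neg] at this
    convert this using 4
    push_cast
    ring
  have g1 := norm_half_sum_fract_mul_kernel_le hq hK (Nat.div_le_self q 2) hneg
    (⌊s * q⌋ * (p / q)) hz2 (y := fun h => ((⌊s * q⌋ - h : ℤ) : ℝ) / q) (fun h => by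
      push_cast
      rw [← sub_div, abs_div, abs_of_pos hq']
      ring_nf
      simp) h1
  have g2 := norm_half_sum_fract_mul_kernel_le hq hK (Nat.sub_le q (q / 2)) hβ
    ((⌊s * q⌋ + 1) * (p / q)) hz2 (y := fun h => ((⌊s * q⌋ + 1 + h : ℤ) : ℝ) / q) (fun h => by
      push_cast
      rw [← sub_div, abs_div, abs_of_pos hq']
      ring_nf
      simp) h2
  have c1 (h : ℕ) : ((⌊s * q⌋ - h : ℤ) : ℝ) * ((p : ℝ) / q) =
      ⌊s * q⌋ * (p / q) + h * (-(p / q)) := by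
    push_cast
    ring
  have c2 (h : ℕ) : ((⌊s * q⌋ + 1 + h : ℤ) : ℝ) * ((p : ℝ) / q) =
      (⌊s * q⌋ + 1) * (p / q) + h * (p / q) := by
    push_cast
    ring
  simp only [c1, c2]
  linarith

/-! ### Products over orbit segments of a rotation -/

/-- A lower bound on `j |jα - M|` for `j < q` is inherited by the inverse `p'` of `p` modulo `q`,
where `p / q` approximates `α`. -/
theorem le_mul_abs_inverse_div_sub {α : ℝ} {p p' m : ℤ} {q : ℕ} (hq : 2 ≤ q)
    (hpp : p * p' = 1 + q * m) {C γ : ℝ} (hC : 1 ≤ C) (hγ0 : 0 < γ) (hγ1 : γ ≤ 1)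
    (hγ : q * |q * α - p| = γ)
    (H : ∀ j : ℤ, j ≠ 0 → |j| < q → ∀ M : ℤ, γ ≤ C * (|(j : ℝ)| * |j * α - M|))
    {Q : ℕ} (hQ : 0 < Q) (hQq : Q ≤ Nat.sqrt q) (P : ℤ) :
    1 ≤ 2 * C / γ * (Q * |Q * (p' / q : ℝ) - P|) := by
  have hq' : (0 : ℝ) < q := by
    have : 0 < q := by omega
    exact_mod_cast this
  have hQ1 : (1 : ℝ) ≤ Q := by exact_mod_cast hQ
  set j : ℤ := Q * p' - P * q with hj
  have hjq : |Q * (p' / q : ℝ) - P| = |(j : ℝ)| / q := by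
    rw [← abs_of_pos hq', ← abs_div, abs_of_pos hq', hj]
    congr 1
    push_cast
    field_simp
  rw [hjq]
  have hK : 2 ≤ 2 * C / γ := by
    rw [le_div_iff₀ hγ0]
    linarith
  have hj0 : j ≠ 0 := by
    intro h0
    have h1 : (q : ℤ) ∣ Q := by
      refine ⟨P * p - Q * m, ?_⟩
      have : (Q : ℤ) * p' = P * q := by rw [hj] at h0; linarith
      linear_combination p * this - Q * hpp
    have h2 := Nat.le_of_dvd hQ (Int.natCast_dvd_natCast.mp h1)
    have h3 := Nat.sqrt_lt_self (n := q) (by omega)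
    omega
  rcases lt_or_ge |j| (q : ℤ) with hlt | hge
  · have h1 := H j hj0 hlt (Q * m - P * p)
    have e1 : j * α - ((Q * m - P * p : ℤ) : ℝ) = j * (q * α - p) / q + Q / q := by
      have h2 : (p : ℝ) * p' = 1 + q * m := by exact_mod_cast hpp
      rw [hj]
      push_cast
      field_simp
      linear_combination (Q : ℝ) * h2
    have hlt' : |(j : ℝ)| ≤ q := by exact_mod_cast hlt.le
    have h3 : |q * α - p| ≤ 1 / q := by
      rw [le_div_iff₀ hq']
      linarith
    have h4 : |j * α - ((Q * m - P * p : ℤ) : ℝ)| ≤ 2 * Q / q := by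
      rw [e1]
      refine (abs_add_le _ _).trans ?_
      rw [abs_div, abs_mul, abs_of_pos hq', abs_of_nonneg (by positivity : (0 : ℝ) ≤ Q / q)]
      calc |(j : ℝ)| * |q * α - p| / q + Q / q ≤ q * (1 / q) / q + Q / q := by gcongr
        _ = (1 + Q) / q := by field_simp
        _ ≤ _ := by gcongr; linarith
    have h5 : γ ≤ C * (|(j : ℝ)| * (2 * Q / q)) := h1.trans (by gcongr)
    rw [div_mul_eq_mul_div, le_div_iff₀ hγ0, one_mul]
    refine h5.trans (le_of_eq ?_)
    ring
  · have h1 : (1 : ℝ) ≤ |(j : ℝ)| / q := by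
      rw [le_div_iff₀ hq', one_mul]
      exact_mod_cast hge
    nlinarith [mul_le_mul hQ1 h1 zero_le_one (by linarith)]

/-- Perturbing the roots of `z ^ q - 1`: the first order term is a discrepancy sum. -/
theorem prod_norm_sub_e_mul_e_le {q : ℕ} (hq : 0 < q) {p p' m : ℤ}
    (hpp : p * p' = 1 + q * m) {γ K δ : ℝ} (hγ1 : γ ≤ 1)
    (hδ : |δ| ≤ γ / (q : ℝ) ^ 2) (hK : 1 ≤ K)
    (hβ : ∀ Q : ℕ, 0 < Q → Q ≤ Nat.sqrt q → ∀ P : ℤ, 1 ≤ K * (Q * |Q * (p' / q : ℝ) - P|))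
    {z : ℂ} (hz : ‖z‖ = 1 + 1 / q) :
    ∏ j ∈ Finset.range q, ‖z - e (j * p / q) * e ((j - q / 2) * δ)‖ ≤
      ‖z ^ q - 1‖ * Real.exp (2000 + 1024 * Real.pi ^ 2 * (γ * K)) := by
  have hq' : (0 : ℝ) < q := by exact_mod_cast hq
  have hp3 := Real.pi_gt_three
  have hp4 := Real.pi_lt_four
  have hγ0 : 0 ≤ γ := by
    have h1 := (abs_nonneg δ).trans hδ
    by_contra hneg
    have : γ / (q : ℝ) ^ 2 < 0 := div_neg_of_neg_of_pos (not_le.mp hneg) (by positivity)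
    linarith
  have hcop : IsCoprime p (q : ℤ) := ⟨p', -m, by linear_combination hpp⟩
  have hqz : (q : ℝ) ≠ 0 := hq'.ne'
  have hper (x y : ℤ) : e (((x + q * y : ℤ) : ℝ) / q) = e (x / q) := e_div_periodic hq x y
  set w : ℕ → ℂ := fun j => e (j * p / q) with hw
  have hw' (j : ℕ) : w j = e (((0 + j * p : ℤ) : ℝ) / q) := by
    simp only [hw]
    push_cast
    rw [zero_add]
  have hwn (j : ℕ) : ‖w j‖ = 1 := norm_e _
  have hdist (j : ℕ) : 1 / (q : ℝ) ≤ ‖z - w j‖ := by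
    have := norm_sub_e_ge_sub_one z (j * p / q)
    rwa [hz, add_sub_cancel_left] at this
  have hne (j : ℕ) : z - w j ≠ 0 := norm_pos_iff.mp (lt_of_lt_of_le (by positivity) (hdist j))
  set η : ℕ → ℝ := fun j => (j - q / 2) * δ with hη
  have hηb (j : ℕ) (hj : j ∈ Finset.range q) : 2 * Real.pi * |η j| ≤ 4 / q := by
    have hjq : (j : ℝ) ≤ q := by exact_mod_cast (Finset.mem_range.mp hj).le
    have h1 : |(j : ℝ) - q / 2| ≤ q / 2 := by
      rw [abs_le]
      constructor <;> linarith [Nat.cast_nonneg (α := ℝ) j]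
    calc 2 * Real.pi * |η j| = 2 * Real.pi * (|(j : ℝ) - q / 2| * |δ|) := by rw [hη, abs_mul]
      _ ≤ 2 * Real.pi * (q / 2 * (1 / (q : ℝ) ^ 2)) := by
          gcongr
          exact hδ.trans (by gcongr)
      _ = Real.pi / q := by field_simp
      _ ≤ 4 / q := by gcongr
  set ξ : ℕ → ℂ := fun j => -(w j * (e (η j) - 1)) / (z - w j) with hξ
  have hfac (j : ℕ) : z - e (j * p / q) * e ((j - q / 2) * δ) = (z - w j) * (1 + ξ j) := by
    have := hne j
    simp only [hξ, hη, hw] at this ⊢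
    field_simp
    ring
  have hξn (j : ℕ) (hj : j ∈ Finset.range q) : ‖ξ j‖ ≤ 4 / q * ‖z - w j‖⁻¹ := by
    simp only [hξ]
    rw [norm_div, norm_neg, norm_mul, hwn, one_mul, div_eq_mul_inv]
    gcongr
    exact (norm_e_sub_one_le _).trans (hηb j hj)
  -- quadratic terms
  have hquad : ∑ j ∈ Finset.range q, ‖ξ j‖ ^ 2 / 2 ≤ 192 := by
    obtain ⟨s, hs⟩ := exists_eq_norm_mul_e z
    rw [hz] at hs
    have h1 := sum_inv_norm_sq_le hq s
    rw [← hs, ← sum_range_progression hq hcop 0 (fun x => (‖z - e ((x : ℤ) / q)‖ ^ 2)⁻¹)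
      (fun x y => by simp only [hper])] at h1
    calc _ ≤ ∑ j ∈ Finset.range q, 8 / (q : ℝ) ^ 2 * (‖z - w j‖ ^ 2)⁻¹ := by
          refine Finset.sum_le_sum fun j hj => ?_
          have h2 := pow_le_pow_left₀ (norm_nonneg _) (hξn j hj) 2
          have h3 : (4 / q * ‖z - w j‖⁻¹) ^ 2 / 2 = 8 / (q : ℝ) ^ 2 * (‖z - w j‖ ^ 2)⁻¹ := by
            ring
          linarith
      _ ≤ 8 / (q : ℝ) ^ 2 * (24 * (q : ℝ) ^ 2) := by
          rw [← Finset.mul_sum]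
          simp only [hw']
          gcongr
      _ = 192 := by
          field_simp
          norm_num
  -- linear terms
  set ζ : ℕ → ℂ := fun j => -(w j * (Complex.I * ((2 * Real.pi * η j : ℝ) : ℂ))) / (z - w j) with hζ
  have herr (j : ℕ) (hj : j ∈ Finset.range q) : ‖ξ j - ζ j‖ ≤ 32 / q := by
    have h1 : ξ j - ζ j =
        -(w j * (e (η j) - 1 - Complex.I * ((2 * Real.pi * η j : ℝ) : ℂ))) / (z - w j) := by
      simp only [hξ, hζ]
      ring
    rw [h1, norm_div, norm_neg, norm_mul, hwn, one_mul]
    calc _ ≤ 2 * (4 / (q : ℝ)) ^ 2 / (1 / q) := by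
          gcongr
          · exact (norm_e_sub_one_sub_le _).trans (by gcongr; exact hηb j hj)
          · exact hdist j
      _ = _ := by
          field_simp
          norm_num
  have hmain : ‖∑ j ∈ Finset.range q, ζ j‖ ≤ 1024 * Real.pi ^ 2 * (γ * K) := by
    have h1 := norm_sum_fract_mul_kernel_le hq (p := p') hK hβ hz
    rw [← sum_range_progression hq hcop 0 (fun x => ((Int.fract ((x : ℝ) * (p' / q)) - 1 / 2 : ℝ) : ℂ) *
      (e (x / q) / (z - e (x / q)))) (fun x y => by
        simp only [hper]
        have e1 : (((x + q * y : ℤ) : ℝ) * (p' / q)) = x * (p' / q) + (y * p' : ℤ) := by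
          push_cast
          field_simp
        rw [e1, Int.fract_add_intCast])] at h1
    have h2 (j : ℕ) (hj : j ∈ Finset.range q) :
        Int.fract (((0 + j * p : ℤ) : ℝ) * ((p' : ℝ) / q)) = j / q := by
      have hpp' : (p : ℝ) * p' = 1 + q * m := by exact_mod_cast hpp
      have e1 : ((0 + j * p : ℤ) : ℝ) * ((p' : ℝ) / q) = j / q + (j * m : ℤ) := by
        push_cast
        field_simp
        linear_combination (j : ℝ) * hpp'
      rw [e1, Int.fract_add_intCast, Int.fract_eq_self]
      constructor
      · positivity
      · rw [div_lt_one hq']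
        exact_mod_cast Finset.mem_range.mp hj
    have h3 : ∑ j ∈ Finset.range q, ζ j = -(Complex.I * ((2 * Real.pi * δ * q : ℝ) : ℂ)) *
        ∑ j ∈ Finset.range q,
        ((Int.fract (((0 + j * p : ℤ) : ℝ) * ((p' : ℝ) / q)) - 1 / 2 : ℝ) : ℂ) *
          (e (((0 + j * p : ℤ) : ℝ) / q) / (z - e (((0 + j * p : ℤ) : ℝ) / q))) := by
      rw [Finset.mul_sum]
      refine Finset.sum_congr rfl fun j hj => ?_
      rw [h2 j hj, ← hw']
      simp only [hζ, hη]
      have hqc : (q : ℂ) ≠ 0 := by exact_mod_cast hq.ne'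
      have := hne j
      push_cast
      field_simp
    rw [h3, norm_mul, norm_neg, norm_mul, Complex.norm_I, one_mul, Complex.norm_real,
      Real.norm_eq_abs, abs_mul, abs_mul, abs_of_pos Real.two_pi_pos, abs_of_pos hq']
    calc _ ≤ 2 * Real.pi * (γ / (q : ℝ) ^ 2) * q * (512 * Real.pi * K * q) := by
          gcongr
      _ = _ := by
          field_simp
          ring
  have hre : ∑ j ∈ Finset.range q, (ξ j).re ≤ 32 + 1024 * Real.pi ^ 2 * (γ * K) := by
    rw [← Complex.re_sum]
    refine (Complex.re_le_norm _).trans ?_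
    have e1 : ∑ j ∈ Finset.range q, ξ j =
        ∑ j ∈ Finset.range q, (ξ j - ζ j) + ∑ j ∈ Finset.range q, ζ j := by
      rw [Finset.sum_sub_distrib, sub_add_cancel]
    rw [e1]
    refine (norm_add_le _ _).trans (add_le_add ?_ hmain)
    refine (norm_sum_le _ _).trans ((Finset.sum_le_sum herr).trans ?_)
    rw [Finset.sum_const, Finset.card_range, nsmul_eq_mul]
    field_simp
    exact le_rfl
  have hprod : ∏ j ∈ Finset.range q, ‖z - w j‖ = ‖z ^ q - 1‖ := by
    rw [← prod_sub_e_div hq z, ← norm_prod]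
    have := prod_range_progression hq hcop 0 (fun x => z - e ((x : ℤ) / q))
      (fun x y => by simp only [hper])
    simp only [hw']
    rw [this]
    push_cast
    rfl
  calc ∏ j ∈ Finset.range q, ‖z - e (j * p / q) * e ((j - q / 2) * δ)‖
      ≤ ∏ j ∈ Finset.range q, (‖z - w j‖ * Real.exp ((ξ j).re + ‖ξ j‖ ^ 2 / 2)) := by
        refine Finset.prod_le_prod (fun _ _ => norm_nonneg _) fun j _ => ?_
        rw [hfac, norm_mul]
        gcongr
        exact norm_one_add_le_exp _
    _ = ‖z ^ q - 1‖ * Real.exp (∑ j ∈ Finset.range q, ((ξ j).re + ‖ξ j‖ ^ 2 / 2)) := by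
        rw [Finset.prod_mul_distrib, hprod, Real.exp_sum]
    _ ≤ _ := by
        gcongr
        rw [Finset.sum_add_distrib]
        linarith

/-- If the denominator `q` of a rational approximation of `α` is, up to a constant, a record for
`j ‖jα‖`, then `∏_{j < q} |z - e(jα)|` is bounded on the unit disc by a constant. -/
theorem prod_norm_sub_e_le {α : ℝ} {p : ℤ} {q : ℕ} (hq : 0 < q) (hp : IsCoprime p (q : ℤ))
    {C γ : ℝ} (hC : 1 ≤ C) (hγ0 : 0 < γ) (hγ1 : γ ≤ 1) (hγ : q * |q * α - p| = γ)
    (H : ∀ j : ℤ, j ≠ 0 → |j| < q → ∀ M : ℤ, γ ≤ C * (|(j : ℝ)| * |j * α - M|))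
    {z : ℂ} (hz : ‖z‖ ≤ 1) :
    ∏ j ∈ Finset.range q, ‖z - e (j * α)‖ ≤ 4 * Real.exp (2000 + 2048 * Real.pi ^ 2 * C) := by
  have hq' : (0 : ℝ) < q := by exact_mod_cast hq
  have hE : 1 ≤ Real.exp (2000 + 2048 * Real.pi ^ 2 * C) := Real.one_le_exp (by positivity)
  rcases Nat.lt_or_ge q 2 with hq2 | hq2
  · obtain rfl : q = 1 := by omega
    simp only [Finset.range_one, Finset.prod_singleton]
    have := norm_sub_le z (e ((0 : ℕ) * α))
    rw [norm_e] at this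
    linarith
  obtain ⟨p', m, hpm⟩ := hp
  have hpp : p * p' = 1 + q * (-m) := by linear_combination hpm
  have hβ := fun Q hQ hQq P => le_mul_abs_inverse_div_sub hq2 hpp hC hγ0 hγ1 hγ H
    (Q := Q) hQ hQq P
  set δ : ℝ := α - p / q with hδ
  have hδb : |δ| ≤ γ / (q : ℝ) ^ 2 := by
    rw [le_div_iff₀ (by positivity), ← hγ]
    have e1 : q * α - p = q * δ := by
      rw [hδ]
      field_simp
    rw [e1, abs_mul, abs_of_pos hq']
    apply le_of_eq
    ring
  have hcircle (y : ℂ) (hy : ‖y‖ = 1 + 1 / q) :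
      ‖∏ j ∈ Finset.range q, (y - e (j * α))‖ ≤
        4 * Real.exp (2000 + 2048 * Real.pi ^ 2 * C) := by
    have hK : 1 ≤ 2 * C / γ := by
      rw [le_div_iff₀ hγ0]
      linarith
    have hy' : ‖y * e (-(q / 2 * δ))‖ = 1 + 1 / q := by rw [norm_mul, norm_e, mul_one, hy]
    have h1 := prod_norm_sub_e_mul_e_le hq hpp hγ1 hδb hK hβ hy'
    have h2 (j : ℕ) : ‖y * e (-(q / 2 * δ)) - e (j * p / q) * e ((j - q / 2) * δ)‖ =
        ‖y - e (j * α)‖ := by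
      have e1 : e (j * p / q) * e ((j - q / 2) * δ) = e (j * α) * e (-(q / 2 * δ)) := by
        rw [← e_add, ← e_add, hδ]
        congr 1
        ring
      rw [e1, ← sub_mul, norm_mul, norm_e, mul_one]
    simp only [h2] at h1
    rw [norm_prod]
    refine h1.trans ?_
    have e3 : 1024 * Real.pi ^ 2 * (γ * (2 * C / γ)) = 2048 * Real.pi ^ 2 * C := by
      field_simp
      norm_num
    rw [e3]
    gcongr
    refine (norm_sub_le _ _).trans ?_
    rw [norm_pow, hy', norm_one]
    have h4 : (1 + 1 / (q : ℝ)) ^ q ≤ Real.exp 1 := by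
      have h5 := pow_le_pow_left₀ (by positivity) (Real.add_one_le_exp (1 / (q : ℝ))) q
      rw [← Real.exp_nat_mul, mul_one_div_cancel hq'.ne'] at h5
      rwa [add_comm]
    have := Real.exp_one_lt_d9
    linarith
  have hmax := Complex.norm_le_of_forall_mem_frontier_norm_le
    (f := fun y => ∏ j ∈ Finset.range q, (y - e (j * α)))
    (Metric.isBounded_ball (x := (0 : ℂ)) (r := 1 + 1 / (q : ℝ)))
    (Differentiable.diffContOnCl (by fun_prop)) (fun y hy => hcircle y (by
      rw [frontier_ball _ (by positivity)] at hy
      simpa using hy)) (z := z) (subset_closure (by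
        have : 0 < 1 / (q : ℝ) := by positivity
        rw [mem_ball_zero_iff]
        linarith))
  simpa only [norm_prod] using hmax

/-! ### Convergents -/

theorem exists_int_eq_contsAux (v : ℝ) (n : ℕ) :
    ∃ a b : ℤ, (GenContFract.of v).contsAux n = ⟨(a : ℝ), (b : ℝ)⟩ := by
  suffices h : (∃ a b : ℤ, (GenContFract.of v).contsAux n = ⟨(a : ℝ), (b : ℝ)⟩) ∧
      ∃ a b : ℤ, (GenContFract.of v).contsAux (n + 1) = ⟨(a : ℝ), (b : ℝ)⟩ from h.1
  induction n with
  | zero =>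
    refine ⟨⟨1, 0, by simp [GenContFract.contsAux]⟩, ⌊v⌋, 1, ?_⟩
    simp [GenContFract.contsAux]
  | succ n ih =>
    refine ⟨ih.2, ?_⟩
    obtain ⟨⟨a, b, h1⟩, a', b', h2⟩ := ih
    rcases hs : (GenContFract.of v).s.get? n with _ | gp
    · exact ⟨a', b', by rw [GenContFract.contsAux, hs]; exact h2⟩
    · obtain ⟨h3, z, h4⟩ := GenContFract.of_partNum_eq_one_and_exists_int_partDen_eq hs
      refine ⟨z * a' + a, z * b' + b, ?_⟩
      rw [GenContFract.contsAux_recurrence hs h1 h2, h3, h4]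
      push_cast
      simp

theorem convergent_approx {α : ℝ} (hα : Irrational α) (n : ℕ) :
    (α.convergent n).den * |(α.convergent n).den * α - (α.convergent n).num| ≤ 1 ∧
    |(α.convergent n).den * α - (α.convergent n).num| ≤ 1 / Nat.fib (n + 2) := by
  have hnt : ¬ (GenContFract.of α).TerminatedAt n := by
    intro h
    obtain ⟨r, hr⟩ := GenContFract.exists_rat_eq_of_terminates ⟨n, h⟩
    exact hα ⟨r, hr.symm⟩
  have h1 := GenContFract.abs_sub_convs_le hnt
  have h2 := GenContFract.of_den_mono (v := α) (n := n)
  have h3 := GenContFract.succ_nth_fib_le_of_nth_den (v := α) (n := n + 1) (Or.inr hnt)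
  have h4 : (Nat.fib (n + 1) : ℝ) ≤ (GenContFract.of α).dens n := by
    refine GenContFract.succ_nth_fib_le_of_nth_den (Or.inr ?_)
    exact mt (GenContFract.terminated_stable n.pred_le) hnt
  have h5 := Real.convs_eq_convergent α n
  obtain ⟨a, b, hab⟩ := exists_int_eq_contsAux α (n + 1)
  have hb : (GenContFract.of α).dens n = b := by
    rw [GenContFract.den_eq_conts_b, GenContFract.nth_cont_eq_succ_nth_contAux, hab]
  have hc : (GenContFract.of α).convs n = a / b := by
    rw [GenContFract.conv_eq_num_div_den, GenContFract.num_eq_conts_a,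
      GenContFract.den_eq_conts_b, GenContFract.nth_cont_eq_succ_nth_contAux, hab]
  set r := α.convergent n with hr
  have hrab : r = (a : ℚ) / b := by
    have : (r : ℝ) = a / b := by rw [← h5, hc]
    exact_mod_cast this
  have hfib : 0 < (Nat.fib (n + 1) : ℝ) := by exact_mod_cast Nat.fib_pos.mpr n.succ_pos
  have hfib2 : 0 < (Nat.fib (n + 2) : ℝ) := by exact_mod_cast Nat.fib_pos.mpr (n + 1).succ_pos
  set D := (GenContFract.of α).dens n with hD
  set D' := (GenContFract.of α).dens (n + 1) with hD'
  have hDpos : 0 < D := hfib.trans_le h4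
  have hbpos : 0 < b := by
    rw [hb] at hDpos
    exact_mod_cast hDpos
  have hden : (r.den : ℝ) ≤ D := by
    rw [hb]
    have h6 : (r.den : ℤ) ∣ b := by
      rw [hrab, ← Rat.divInt_eq_div]
      exact Rat.den_dvd a b
    exact_mod_cast Int.le_of_dvd hbpos h6
  have hD'pos : 0 < D' := hDpos.trans_le h2
  have hrd : (0 : ℝ) < r.den := by exact_mod_cast r.den_pos
  have h7 : |r.den * α - r.num| ≤ 1 / D' := by
    have e1 : r.den * α - r.num = r.den * (α - r) := by
      rw [Rat.cast_def]
      field_simp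
    rw [e1, abs_mul, abs_of_pos hrd]
    rw [h5] at h1
    calc r.den * |α - r| ≤ D * (1 / (D * D')) := by gcongr
      _ = 1 / D' := by field_simp
  constructor
  · calc r.den * |r.den * α - r.num| ≤ D' * (1 / D') := by
          gcongr
          exact hden.trans h2
      _ = 1 := by field_simp
  · exact h7.trans (one_div_le_one_div_of_le hfib2 h3)

theorem abs_den_mul_sub_num (α : ℝ) (r : ℚ) :
    |r.den * α - r.num| = r.den * |α - r| := by
  have hrd : (0 : ℝ) < r.den := by exact_mod_cast r.den_pos
  rw [← abs_of_pos hrd, ← abs_mul, abs_of_pos hrd, Rat.cast_def]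
  congr 1
  field_simp

theorem abs_den_mul_sub_num_pos {α : ℝ} (hα : Irrational α) (r : ℚ) :
    0 < |r.den * α - r.num| := by
  rw [abs_den_mul_sub_num]
  have hrd : (0 : ℝ) < r.den := by exact_mod_cast r.den_pos
  refine mul_pos hrd (abs_pos.mpr (sub_ne_zero.mpr ?_))
  rintro rfl
  exact hα ⟨r, rfl⟩

theorem den_mul_abs_le_of_int {α : ℝ} {j : ℤ} (hj : j ≠ 0) (M : ℤ) :
    ((M / j : ℚ).den : ℝ) * |(M / j : ℚ).den * α - (M / j : ℚ).num| ≤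
      |(j : ℝ)| * |j * α - M| ∧ ((M / j : ℚ).den : ℤ) ≤ |j| := by
  have hj' : (j : ℝ) ≠ 0 := by exact_mod_cast hj
  have h1 : ((M / j : ℚ).den : ℤ) ≤ |j| :=
    Int.le_of_dvd (abs_pos.mpr hj) ((dvd_abs _ _).mpr (by
      rw [← Rat.divInt_eq_div]
      exact Rat.den_dvd M j))
  refine ⟨?_, h1⟩
  have h2 : ((M / j : ℚ).den : ℝ) ≤ |(j : ℝ)| := by exact_mod_cast h1
  rw [abs_den_mul_sub_num]
  have e1 : |j * α - M| = |(j : ℝ)| * |α - (M / j : ℚ)| := by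
    rw [← abs_mul]
    congr 1
    push_cast
    field_simp
  rw [e1]
  gcongr

/-- Infinitely many convergents of an irrational number have denominators which are, up to a
constant, records for `j ‖jα‖`. -/
theorem exists_frequently_convergent_record {α : ℝ} (hα : Irrational α) :
    ∃ C : ℝ, 1 ≤ C ∧ ∃ᶠ n in atTop,
      (α.convergent n).den * |(α.convergent n).den * α - (α.convergent n).num| ≤ 1 ∧
      ∀ j : ℤ, j ≠ 0 → |j| < (α.convergent n).den → ∀ M : ℤ,
        (α.convergent n).den * |(α.convergent n).den * α - (α.convergent n).num| ≤
          C * (|(j : ℝ)| * |j * α - M|) := by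
  by_cases hinf : ∃ c₀ : ℝ, 0 < c₀ ∧ ∀ j : ℤ, j ≠ 0 → ∀ M : ℤ, c₀ ≤ |(j : ℝ)| * |j * α - M|
  · obtain ⟨c₀, hc₀, h⟩ := hinf
    refine ⟨max 1 (1 / c₀), le_max_left _ _, Frequently.of_forall fun n => ?_⟩
    have h1 := (convergent_approx hα n).1
    refine ⟨h1, fun j hj _ M => h1.trans ?_⟩
    calc (1 : ℝ) = 1 / c₀ * c₀ := by field_simp
      _ ≤ _ := by
        gcongr
        · exact le_max_right _ _
        · exact h j hj M
  · push Not at hinf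
    refine ⟨1, le_rfl, ?_⟩
    rw [frequently_atTop]
    intro N
    let φ : ℚ → ℝ := fun r => r.den * |r.den * α - r.num|
    have hφ (r : ℚ) : 0 < φ r :=
      mul_pos (by exact_mod_cast r.den_pos) (abs_den_mul_sub_num_pos hα r)
    obtain ⟨ε, hε0, hε1, hεN⟩ : ∃ ε : ℝ, 0 < ε ∧ ε ≤ 1 / 2 ∧
        ∀ n < N, ε ≤ φ (α.convergent n) := by
      induction N with
      | zero => exact ⟨1 / 2, by norm_num, le_rfl, by simp⟩
      | succ N ih =>
        obtain ⟨ε, h0, h1, h2⟩ := ih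
        refine ⟨min ε (φ (α.convergent N)), lt_min h0 (hφ _), (min_le_left _ _).trans h1, ?_⟩
        intro n hn
        rcases Nat.lt_succ_iff_lt_or_eq.mp hn with h | rfl
        · exact (min_le_left _ _).trans (h2 n h)
        · exact min_le_right _ _
    have hex : ∃ d : ℕ, ∃ r : ℚ, r.den = d ∧ φ r < ε := by
      obtain ⟨j, hj, M, h⟩ := hinf ε hε0
      exact ⟨_, (M / j : ℚ), rfl, (den_mul_abs_le_of_int hj M).1.trans_lt h⟩
    classical
    obtain ⟨r, hrd, hr⟩ := Nat.find_spec hex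
    have hmin (s : ℚ) (hs : s.den < r.den) : ε ≤ φ s := by
      by_contra hlt
      exact Nat.find_min hex (hrd ▸ hs) ⟨s, rfl, not_le.mp hlt⟩
    have hrd' : (0 : ℝ) < r.den := by exact_mod_cast r.den_pos
    obtain ⟨n, hn⟩ := Real.exists_rat_eq_convergent (ξ := α) (q := r) (by
      rw [lt_div_iff₀ (by positivity)]
      have : φ r = r.den * (r.den * |α - r|) := by
        simp only [φ, abs_den_mul_sub_num]
      have e2 : |α - r| * (2 * (r.den : ℝ) ^ 2) = 2 * φ r := by
        rw [this]
        ring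
      rw [e2]
      linarith)
    refine ⟨n, ?_, ?_⟩
    · by_contra hlt
      have := hεN n (not_le.mp hlt)
      rw [← hn] at this
      linarith
    · rw [← hn]
      refine ⟨by change φ r ≤ 1; linarith, fun j hj hjr M => ?_⟩
      rw [one_mul]
      obtain ⟨h1, h2⟩ := den_mul_abs_le_of_int (α := α) hj M
      have h3 := hmin (M / j) (by exact_mod_cast h2.trans_lt hjr)
      exact hr.le.trans (h3.trans h1)

theorem exists_frequently_prod_norm_sub_e_le {α : ℝ} (hα : Irrational α) :
    ∃ D : ℝ, 1 ≤ D ∧ ∃ᶠ n in atTop, ∀ z : ℂ, ‖z‖ ≤ 1 →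
      ∏ j ∈ Finset.range (q α n), ‖z - e (j * α)‖ ≤ D := by
  obtain ⟨C, hC, h⟩ := exists_frequently_convergent_record hα
  have h1 : 1 ≤ Real.exp (2000 + 2048 * Real.pi ^ 2 * C) := Real.one_le_exp (by positivity)
  refine ⟨4 * Real.exp (2000 + 2048 * Real.pi ^ 2 * C), by linarith, h.mono fun n hn z hz => ?_⟩
  refine prod_norm_sub_e_le (α.convergent n).den_pos (p := (α.convergent n).num) ?_ hC
    (mul_pos (by exact_mod_cast (α.convergent n).den_pos) (abs_den_mul_sub_num_pos hα _))
    hn.1 rfl hn.2 hz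
  rw [Int.isCoprime_iff_gcd_eq_one]
  exact (α.convergent n).reduced

theorem tendsto_q_mul_sub {α : ℝ} (hα : Irrational α) :
    Tendsto (fun n => |q α n * α - (α.convergent n).num|) atTop (nhds 0) := by
  refine squeeze_zero (fun _ => abs_nonneg _) (fun n => (convergent_approx hα n).2) ?_
  refine tendsto_const_nhds.div_atTop ?_
  refine tendsto_natCast_atTop_atTop.comp ?_
  refine tendsto_atTop_mono' atTop ?_ (tendsto_add_atTop_nat 2)
  filter_upwards [eventually_ge_atTop 5] with n hn
  exact Nat.le_fib_self (by omega)

theorem tendsto_q_atTop {α : ℝ} (hα : Irrational α) : Tendsto (q α) atTop atTop := by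
  rw [tendsto_atTop]
  intro b
  have h1 := hα.eventually_forall_le_dist_cast_rat_of_den_le b
  obtain ⟨ε, hε, h2⟩ := Metric.eventually_nhds_iff.mp h1
  have h3 := h2 (y := ε / 2) (by rw [dist_zero_right, Real.norm_eq_abs, abs_of_pos] <;> linarith)
  filter_upwards [(tendsto_q_mul_sub hα).eventually_lt_const (half_pos hε)] with n hn
  by_contra hlt
  have h4 := h3 (α.convergent n) (not_le.mp hlt).le
  have h5 := abs_den_mul_sub_num α (α.convergent n)
  have hd : (1 : ℝ) ≤ (α.convergent n).den := by exact_mod_cast (α.convergent n).den_pos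
  rw [Real.dist_eq] at h4
  have h6 : |q α n * α - (α.convergent n).num| = (α.convergent n).den * |α - α.convergent n| := h5
  rw [h6] at hn
  nlinarith [abs_nonneg (α - α.convergent n)]

/-! ### The sampling function of the dual coupling -/

theorem fourier_point_add (n : ℤ) (x y : UnitAddCircle) :
    (fourier n (x + y) : ℂ) = fourier n x * fourier n y := by
  simp only [fourier_apply, zsmul_add, AddCircle.toCircle_add, Circle.coe_mul]

theorem norm_fourier_apply (n : ℤ) (x : UnitAddCircle) : ‖(fourier n x : ℂ)‖ = 1 :=
  Circle.norm_coe _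

theorem fourier_one_coe (y : ℝ) : (fourier 1 ((y : ℝ) : UnitAddCircle) : ℂ) = e y := by
  rw [fourier_coe_apply, e]
  congr 1
  push_cast
  ring

theorem fourier_neg_one_eq_conj (x : UnitAddCircle) :
    (fourier (-1) x : ℂ) = conj (fourier 1 x : ℂ) := fourier_neg

theorem fourier_one_mul_conj (x : UnitAddCircle) :
    (fourier 1 x : ℂ) * conj (fourier 1 x : ℂ) = 1 := by
  rw [Complex.mul_conj, Complex.normSq_eq_norm_sq, norm_fourier_apply]
  simp

theorem exists_roots_in_disc {a b : ℝ} (hab : b ≤ a) (h : 1 ≤ a + b) :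
    ∃ r₁ r₂ : ℂ, ‖r₁‖ ≤ 1 ∧ ‖r₂‖ ≤ 1 ∧
      ∀ z : ℂ, (a : ℂ) * z ^ 2 + z + b = a * ((z - r₁) * (z - r₂)) := by
  have ha : 0 < a := by linarith
  have ha' : (a : ℂ) ≠ 0 := by exact_mod_cast ha.ne'
  suffices hs : ∃ s : ℂ, s ^ 2 = 1 - 4 * a * b ∧ ‖-1 + s‖ ≤ 2 * a ∧ ‖-1 - s‖ ≤ 2 * a by
    obtain ⟨s, hs, h1, h2⟩ := hs
    have hn (w : ℂ) (hw : ‖w‖ ≤ 2 * a) : ‖w / (2 * a)‖ ≤ 1 := by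
      rw [norm_div, norm_mul, Complex.norm_real, Real.norm_eq_abs, abs_of_pos ha, Complex.norm_ofNat]
      exact div_le_one_of_le₀ hw (by positivity)
    refine ⟨_, _, hn _ h1, hn _ h2, fun z => ?_⟩
    field_simp
    linear_combination hs
  rcases le_total 0 (1 - 4 * a * b) with hD | hD
  · refine ⟨(√(1 - 4 * a * b) : ℝ), ?_, ?_⟩
    · rw [← Complex.ofReal_pow, Real.sq_sqrt hD]
      push_cast
      ring
    · have h1 : √(1 - 4 * a * b) ≤ 2 * a - 1 := by
        rw [Real.sqrt_le_left (by linarith)]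
        nlinarith
      have h0 := Real.sqrt_nonneg (1 - 4 * a * b)
      have e1 : (-1 : ℂ) + (√(1 - 4 * a * b) : ℝ) = ((-1 + √(1 - 4 * a * b) : ℝ) : ℂ) := by
        push_cast
        ring
      have e2 : (-1 : ℂ) - (√(1 - 4 * a * b) : ℝ) = ((-1 - √(1 - 4 * a * b) : ℝ) : ℂ) := by
        push_cast
        ring
      rw [e1, e2, Complex.norm_real, Complex.norm_real, Real.norm_eq_abs, Real.norm_eq_abs,
        abs_le, abs_le]
      refine ⟨⟨?_, ?_⟩, ?_, ?_⟩ <;> linarith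
  · set t := √(4 * a * b - 1) with ht
    have ht2 : t ^ 2 = 4 * a * b - 1 := Real.sq_sqrt (by linarith)
    have hn (u : ℝ) (hu : u ^ 2 = t ^ 2) : ‖(-1 : ℂ) + u * Complex.I‖ ≤ 2 * a := by
      apply le_of_sq_le_sq _ (by positivity)
      rw [← Complex.normSq_eq_norm_sq, Complex.normSq_apply]
      simp
      nlinarith
    refine ⟨t * Complex.I, ?_, hn t rfl, ?_⟩
    · rw [mul_pow, Complex.I_sq, ← Complex.ofReal_pow, ht2]
      push_cast
      ring
    · have := hn (-t) (by ring)
      rwa [Complex.ofReal_neg, neg_mul, ← sub_eq_add_neg] at this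

theorem c_dual (l1 l3 α : ℝ) (x : UnitAddCircle) :
    c (dual l1 l3) α x = (l3 : ℂ) * conj (fourier 1 (x + ((α / 2 : ℝ) : UnitAddCircle)) : ℂ) + 1 +
      l1 * fourier 1 (x + ((α / 2 : ℝ) : UnitAddCircle)) := by
  simp only [c, dual, fourier_neg_one_eq_conj, Complex.ofReal_one]

theorem exists_norm_quadratic_eq {l1 l3 : ℝ} (hl : 1 ≤ l1 + l3) :
    ∃ r₁ r₂ : ℂ, ‖r₁‖ ≤ 1 ∧ ‖r₂‖ ≤ 1 ∧ ∀ z : ℂ, ‖z‖ = 1 →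
      ‖(l3 : ℂ) * conj z + 1 + l1 * z‖ = max l1 l3 * (‖z - r₁‖ * ‖z - r₂‖) := by
  have hz1 (z : ℂ) (hz : ‖z‖ = 1) : z * conj z = 1 := by
    rw [Complex.mul_conj, Complex.normSq_eq_norm_sq, hz]
    simp
  rcases le_total l3 l1 with h | h
  · obtain ⟨r₁, r₂, h1, h2, h3⟩ := exists_roots_in_disc h hl
    refine ⟨r₁, r₂, h1, h2, fun z hz => ?_⟩
    have h4 := h3 z
    have e1 : (l3 : ℂ) * conj z + 1 + l1 * z = conj z * (l1 * z ^ 2 + z + l3) := by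
      linear_combination (-1 - l1 * z) * hz1 z hz
    rw [e1, h4, norm_mul, RCLike.norm_conj, hz, one_mul, norm_mul, norm_mul, Complex.norm_real,
      Real.norm_eq_abs, max_eq_left h, abs_of_pos (by linarith)]
  · obtain ⟨r₁, r₂, h1, h2, h3⟩ := exists_roots_in_disc h (by linarith)
    refine ⟨conj r₁, conj r₂, by rwa [RCLike.norm_conj], by rwa [RCLike.norm_conj], fun z hz => ?_⟩
    have h4 := h3 (conj z)
    have e1 : (l3 : ℂ) * conj z + 1 + l1 * z = z * (l3 * (conj z) ^ 2 + conj z + l1) := by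
      linear_combination (-1 - l3 * conj z) * hz1 z hz
    have e2 (r : ℂ) : ‖conj z - r‖ = ‖z - conj r‖ := by
      rw [← RCLike.norm_conj, map_sub, Complex.conj_conj]
    rw [e1, h4, norm_mul, hz, one_mul, norm_mul, norm_mul, Complex.norm_real,
      Real.norm_eq_abs, max_eq_right h, abs_of_pos (by linarith), e2, e2]

theorem max_pos_of_one_le_add {l1 l3 : ℝ} (hl : 1 ≤ l1 + l3) : 0 < max l1 l3 := by
  rcases le_total l3 l1 with h | h
  · exact lt_max_of_lt_left (by linarith)
  · exact lt_max_of_lt_right (by linarith)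

theorem integral_comp_fourier_one_eq_circleAverage (G : ℂ → ℝ) :
    ∫ x : UnitAddCircle, G (fourier 1 x) ∂AddCircle.haarAddCircle = Real.circleAverage G 0 1 := by
  rw [AddCircle.integral_haarAddCircle, inv_one, one_smul,
    ← UnitAddCircle.intervalIntegral_preimage 0, zero_add, Real.circleAverage_def]
  have h := intervalIntegral.integral_comp_mul_left (a := 0) (b := 1)
    (fun t => G (circleMap 0 1 t)) (c := 2 * Real.pi) Real.two_pi_pos.ne'
  rw [mul_zero, mul_one] at h
  rw [← h]
  refine intervalIntegral.integral_congr fun t _ => ?_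
  rw [fourier_one_coe, e, circleMap]
  congr 1
  push_cast
  ring_nf

theorem circleAverage_log_quadratic {A : ℝ} (hA : 0 < A) {r₁ r₂ : ℂ} (h₁ : ‖r₁‖ ≤ 1)
    (h₂ : ‖r₂‖ ≤ 1) :
    Real.circleAverage (fun z => Real.log (A * (‖z - r₁‖ * ‖z - r₂‖))) 0 1 = Real.log A := by
  have hav (r : ℂ) (hr : ‖r‖ ≤ 1) : Real.circleAverage (fun z => Real.log ‖z - r‖) 0 1 = 0 := by
    rw [circleAverage_log_norm_sub_const_of_mem_closedBall (by simpa using hr), Real.log_one]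
  have hint (r : ℂ) : CircleIntegrable (fun z => Real.log ‖z - r‖) 0 1 :=
    circleIntegrable_log_norm_sub_const 1
  have hc : CircleIntegrable (fun _ : ℂ => Real.log A) 0 1 := circleIntegrable_const _ _ _
  rw [Real.circleAverage_congr_codiscreteWithin
    (f₂ := fun z => Real.log A + Real.log ‖z - r₁‖ + Real.log ‖z - r₂‖) ?_ one_ne_zero]
  · have hc₁ : CircleIntegrable (fun z => Real.log A + Real.log ‖z - r₁‖) 0 1 := hc.add (hint r₁)
    rw [Real.circleAverage_fun_add hc₁ (hint r₂), Real.circleAverage_fun_add hc (hint r₁), hav _ h₁, hav _ h₂, Real.circleAverage_const]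
    simp
  · have hfin : ({r₁, r₂} : Set ℂ).Finite := Set.toFinite _
    filter_upwards [compl_finite_mem_codiscreteWithin hfin] with z hz
    simp only [Set.mem_compl_iff, Set.mem_insert_iff, Set.mem_singleton_iff, not_or] at hz
    have e1 : ‖z - r₁‖ ≠ 0 := norm_ne_zero_iff.mpr (sub_ne_zero.mpr hz.1)
    have e2 : ‖z - r₂‖ ≠ 0 := norm_ne_zero_iff.mpr (sub_ne_zero.mpr hz.2)
    rw [Real.log_mul hA.ne' (mul_ne_zero e1 e2), Real.log_mul e1 e2, add_assoc]

theorem I_dual {l1 l3 : ℝ} (hl : 1 ≤ l1 + l3) (α : ℝ) :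
    I (dual l1 l3) α = Real.log (max l1 l3) := by
  obtain ⟨r₁, r₂, h1, h2, h3⟩ := exists_norm_quadratic_eq hl
  rw [← circleAverage_log_quadratic (max_pos_of_one_le_add hl) h1 h2,
    ← integral_comp_fourier_one_eq_circleAverage]
  rw [← integral_add_right_eq_self
    (fun x : UnitAddCircle => Real.log (max l1 l3 * (‖fourier 1 x - r₁‖ * ‖fourier 1 x - r₂‖)))
    ((α / 2 : ℝ) : UnitAddCircle)]
  refine integral_congr_ae (Eventually.of_forall fun x => ?_)
  simp only [c_dual, h3 _ (norm_fourier_apply _ _)]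

theorem exp_mul_I_dual {l1 l3 : ℝ} (hl : 1 ≤ l1 + l3) (α : ℝ) (n : ℕ) :
    Real.exp (n * I (dual l1 l3) α) = max l1 l3 ^ n := by
  rw [I_dual hl, Real.exp_nat_mul, Real.exp_log (max_pos_of_one_le_add hl)]

theorem fourier_one_rot (α : ℝ) (k : ℤ) (x : UnitAddCircle) :
    (fourier 1 (rot α k x) : ℂ) = fourier 1 x * e (k * α) := by
  rw [rot, fourier_point_add, fourier_one_coe]

theorem norm_d_dual_le {l1 l3 : ℝ} (hl : 1 ≤ l1 + l3) {α D : ℝ} {n : ℕ}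
    (hD : ∀ z : ℂ, ‖z‖ ≤ 1 → ∏ j ∈ Finset.range n, ‖z - e (j * α)‖ ≤ D) (x : UnitAddCircle) :
    ‖d (dual l1 l3) α n x‖ ≤ max l1 l3 ^ n * (D * D) := by
  obtain ⟨r₁, r₂, h1, h2, h3⟩ := exists_norm_quadratic_eq hl
  set ζ : ℂ := fourier 1 (x + ((α / 2 : ℝ) : UnitAddCircle)) with hζ
  have hζ1 : ‖ζ‖ = 1 := norm_fourier_apply _ _
  have hrot (j : ℕ) : (fourier 1 (rot α j x + ((α / 2 : ℝ) : UnitAddCircle)) : ℂ) =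
      ζ * e (j * α) := by
    rw [fourier_point_add, fourier_one_rot, hζ, fourier_point_add]
    push_cast
    ring
  have hfac (r : ℂ) (hr : ‖r‖ ≤ 1) : ∏ j ∈ Finset.range n, ‖ζ * e (j * α) - r‖ ≤ D := by
    refine le_trans (le_of_eq ?_) (hD (r * conj ζ) (by rw [norm_mul, RCLike.norm_conj, hζ1, mul_one]; exact hr))
    refine Finset.prod_congr rfl fun j _ => ?_
    have e1 : ζ * e (j * α) - r = -(ζ * (r * conj ζ - e (j * α))) := by
      linear_combination r * fourier_one_mul_conj (x + ((α / 2 : ℝ) : UnitAddCircle))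
    rw [e1, norm_neg, norm_mul, hζ1, one_mul]
  have hnn (r : ℂ) : 0 ≤ ∏ j ∈ Finset.range n, ‖ζ * e (j * α) - r‖ :=
    Finset.prod_nonneg fun _ _ => norm_nonneg _
  rw [d, norm_prod]
  have h4 : ∀ j ∈ Finset.range n, ‖c (dual l1 l3) α (rot α j x)‖ =
      max l1 l3 * (‖ζ * e (j * α) - r₁‖ * ‖ζ * e (j * α) - r₂‖) := by
    intro j _
    rw [c_dual, h3 _ (norm_fourier_apply _ _), hrot]
  rw [Finset.prod_congr rfl h4, Finset.prod_mul_distrib, Finset.prod_const, Finset.card_range,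
    Finset.prod_mul_distrib]
  have := (max_pos_of_one_le_add hl).le
  gcongr
  · exact (hnn r₁).trans (hfac r₁ h1)
  · exact hfac r₁ h1
  · exact hfac r₂ h2

theorem exists_isErgodicSubseq {α : ℝ} (hα : Irrational α) {l1 l3 : ℝ} (hl : 1 ≤ l1 + l3) :
    ∃ n : ℕ → ℕ, IsErgodicSubseq (dual l1 l3) α n := by
  obtain ⟨D, hD, h⟩ := exists_frequently_prod_norm_sub_e_le hα
  obtain ⟨n, hn, hn'⟩ := extraction_of_frequently_atTop h
  refine ⟨n, hn, Real.log (D * D), fun l x => ?_⟩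
  rw [Real.exp_add, exp_mul_I_dual hl, Real.exp_log (by positivity)]
  exact norm_d_dual_le hl (hn' l) x

theorem haarAddCircle_eq_volume :
    (AddCircle.haarAddCircle : Measure UnitAddCircle) = volume := by
  rw [AddCircle.volume_eq_smul_haarAddCircle, ENNReal.ofReal_one, one_smul]

instance : NullSingletonClass (AddCircle.haarAddCircle : Measure UnitAddCircle) where
  measure_singleton x := by
    rw [haarAddCircle_eq_volume, ← Metric.closedBall_zero, AddCircle.volume_closedBall]
    simp

theorem ae_c_dual_ne_zero {l1 l3 : ℝ} (hl : 1 ≤ l1 + l3) (α : ℝ) :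
    ∀ᵐ x : UnitAddCircle ∂AddCircle.haarAddCircle, c (dual l1 l3) α x ≠ 0 := by
  obtain ⟨r₁, r₂, -, -, h3⟩ := exists_norm_quadratic_eq hl
  have hsub (r : ℂ) : {x : UnitAddCircle |
      (fourier 1 (x + ((α / 2 : ℝ) : UnitAddCircle)) : ℂ) = r}.Subsingleton := by
    intro x hx y hy
    have h : (fourier 1 (x + ((α / 2 : ℝ) : UnitAddCircle)) : ℂ) =
      fourier 1 (y + ((α / 2 : ℝ) : UnitAddCircle)) := Eq.trans hx (Eq.symm hy)
    rw [fourier_one, fourier_one] at h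
    exact add_right_cancel (AddCircle.injective_toCircle one_ne_zero (Subtype.ext h))
  have hcount : {x : UnitAddCircle | c (dual l1 l3) α x = 0}.Countable := by
    refine ((hsub r₁).countable.union (hsub r₂).countable).mono fun x hx => ?_
    have h4 := h3 _ (norm_fourier_apply 1 (x + ((α / 2 : ℝ) : UnitAddCircle)))
    rw [← c_dual, show c (dual l1 l3) α x = 0 from hx, norm_zero, eq_comm, mul_eq_zero,
      mul_eq_zero, norm_eq_zero, norm_eq_zero, sub_eq_zero, sub_eq_zero] at h4
    rcases h4 with h4 | h4 | h4
    · exact absurd h4 (max_pos_of_one_le_add hl).ne'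
    · exact Or.inl h4
    · exact Or.inr h4
  rw [ae_iff]
  simpa using hcount.measure_zero AddCircle.haarAddCircle

/-! ### Leading Fourier coefficients of trigonometric polynomials -/

/-- `f` is a trigonometric polynomial in `e^{2πisx}` without frequencies above `n`, and `a` is its
coefficient at the frequency `n`. -/
def HasLeading (s : ℤ) (n : ℕ) (f : UnitAddCircle → ℂ) (a : ℂ) : Prop :=
  ∃ P : Polynomial ℂ, P.coeff 0 = a ∧
    ∀ x, f x = fourier (s * n) x * P.eval (fourier (-s) x : ℂ)

theorem HasLeading.mul {s : ℤ} {n k : ℕ} {f g : UnitAddCircle → ℂ} {a b : ℂ}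
    (hf : HasLeading s n f a) (hg : HasLeading s k g b) :
    HasLeading s (n + k) (fun x => f x * g x) (a * b) := by
  obtain ⟨P, hP, h1⟩ := hf
  obtain ⟨Q, hQ, h2⟩ := hg
  refine ⟨P * Q, by rw [Polynomial.mul_coeff_zero, hP, hQ], fun x => ?_⟩
  beta_reduce
  rw [h1, h2, Polynomial.eval_mul]
  push_cast
  rw [mul_add, fourier_add]
  ring

theorem HasLeading.add {s : ℤ} {n : ℕ} {f g : UnitAddCircle → ℂ} {a b : ℂ}
    (hf : HasLeading s n f a) (hg : HasLeading s n g b) :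
    HasLeading s n (fun x => f x + g x) (a + b) := by
  obtain ⟨P, hP, h1⟩ := hf
  obtain ⟨Q, hQ, h2⟩ := hg
  refine ⟨P + Q, by rw [Polynomial.coeff_add, hP, hQ], fun x => ?_⟩
  beta_reduce
  rw [h1, h2, Polynomial.eval_add]
  ring

theorem HasLeading.const_mul {s : ℤ} {n : ℕ} {f : UnitAddCircle → ℂ} {a : ℂ}
    (hf : HasLeading s n f a) (z : ℂ) : HasLeading s n (fun x => z * f x) (z * a) := by
  obtain ⟨P, hP, h1⟩ := hf
  refine ⟨Polynomial.C z * P, by rw [Polynomial.coeff_C_mul, hP], fun x => ?_⟩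
  beta_reduce
  rw [h1, Polynomial.eval_mul, Polynomial.eval_C]
  ring

theorem fourier_mul_fourier_neg (s : ℤ) (x : UnitAddCircle) :
    (fourier s x : ℂ) * fourier (-s) x = 1 := by
  rw [← fourier_add, add_neg_cancel, fourier_zero]

theorem hasLeading_const_zero (s : ℤ) (z : ℂ) : HasLeading s 0 (fun _ => z) z :=
  ⟨Polynomial.C z, by simp, fun x => by simp⟩

theorem hasLeading_const_one (s : ℤ) (z : ℂ) : HasLeading s 1 (fun _ => z) 0 := by
  refine ⟨Polynomial.C z * Polynomial.X, by simp, fun x => ?_⟩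
  have := fourier_mul_fourier_neg s x
  simp only [Polynomial.eval_mul, Polynomial.eval_C, Polynomial.eval_X, Nat.cast_one, mul_one]
  linear_combination (-z) * this

theorem hasLeading_trinomial (s : ℤ) (a b : ℂ) :
    HasLeading s 1 (fun x => a * fourier s x + 1 + b * fourier (-s) x) a := by
  refine ⟨Polynomial.C a + Polynomial.X + Polynomial.C b * Polynomial.X ^ 2, by simp, fun x => ?_⟩
  have := fourier_mul_fourier_neg s x
  simp only [Polynomial.eval_mul, Polynomial.eval_C, Polynomial.eval_X, Polynomial.eval_add,
    Polynomial.eval_pow, Nat.cast_one, mul_one]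
  linear_combination (-1 - b * (fourier (-s) x : ℂ)) * this

theorem integral_fourier {k : ℤ} (hk : k ≠ 0) :
    ∫ x : UnitAddCircle, (fourier k x : ℂ) ∂AddCircle.haarAddCircle = 0 := by
  have h := congrFun (fourierCoeff_fourier (T := 1) k) 0
  rw [fourierCoeff] at h
  simpa [hk.symm] using h

theorem integrable_fourier (k : ℤ) :
    Integrable (fun x : UnitAddCircle => (fourier k x : ℂ)) AddCircle.haarAddCircle :=
  (ContinuousMap.continuous _).integrable_of_hasCompactSupport
    (HasCompactSupport.of_compactSpace _)

theorem fourier_neg_pow (s : ℤ) (i : ℕ) (x : UnitAddCircle) :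
    (fourier (-s) x : ℂ) ^ i = fourier (-s * i) x := by
  induction i with
  | zero => simp
  | succ i ih =>
    rw [pow_succ, ih, ← fourier_add]
    congr 2
    push_cast
    ring

theorem HasLeading.fourierCoeff_eq {s : ℤ} (hs : s ≠ 0) {n : ℕ} {f : UnitAddCircle → ℂ} {a : ℂ}
    (hf : HasLeading s n f a) : fourierCoeff f (s * n) = a := by
  obtain ⟨P, hP, h⟩ := hf
  rw [fourierCoeff]
  have h1 : ∀ x : UnitAddCircle, fourier (-(s * n)) x • f x =
      ∑ i ∈ Finset.range (P.natDegree + 1), P.coeff i * fourier (-s * i) x := by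
    intro x
    rw [h, smul_eq_mul, ← mul_assoc, mul_comm (fourier (-(s * n)) x : ℂ),
      fourier_mul_fourier_neg, one_mul, Polynomial.eval_eq_sum_range]
    simp only [fourier_neg_pow]
  simp only [h1]
  rw [integral_finsetSum _ fun i _ => (integrable_fourier _).const_mul _,
    Finset.sum_eq_single 0]
  · simp [hP]
  · intro i _ hi
    rw [integral_const_mul, integral_fourier, mul_zero]
    simpa [hs] using hi
  · simp

/-! ### The leading coefficient of `Ψ` -/

/-- The product of the matrices `c(x) B(x)` along the orbit of `x`. -/
noncomputable def numer (lam : Coupling) (α E : ℝ) : ℕ → UnitAddCircle → Matrix (Fin 2) (Fin 2) ℂ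
  | 0, _ => 1
  | n + 1, x => !![(E : ℂ), -conj (c lam α (rot α (-1) (rot α n x))); c lam α (rot α n x), 0] *
      numer lam α E n x

theorem d_succ (lam : Coupling) (α : ℝ) (n : ℕ) (x : UnitAddCircle) :
    d lam α (n + 1) x = d lam α n x * c lam α (rot α n x) := by
  rw [d, Finset.prod_range_succ, d]

theorem d_smul_iter (lam : Coupling) (α E : ℝ) (n : ℕ) (x : UnitAddCircle)
    (h : ∀ k : ℤ, c lam α (rot α k x) ≠ 0) : d lam α n x • iter lam α E n x = numer lam α E n x := by
  induction n with
  | zero => simp [d, iter, numer]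
  | succ n ih =>
    rw [d_succ, iter, numer, ← ih, B, Matrix.smul_mul, Matrix.mul_smul, smul_smul, mul_assoc,
      mul_inv_cancel₀ (h n), mul_one]

theorem R_pow (θ : UnitAddCircle) (n : ℕ) :
    R θ ^ n = !![(fourier n θ : ℂ), 0; 0, fourier (-n) θ] := by
  induction n with
  | zero => simp [Matrix.one_fin_two]
  | succ n ih =>
    rw [pow_succ, ih, R, Matrix.mul_fin_two]
    push_cast
    rw [neg_add, fourier_add, fourier_add]
    simp

theorem R_pow_trace (θ : UnitAddCircle) (n : ℕ) :
    (R θ ^ n).trace = fourier n θ + fourier (-n) θ := by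
  rw [R_pow, Matrix.trace_fin_two_of]

section Leading

variable {lam : Coupling} {α : ℝ} {s : ℤ} {a b : ℂ}

theorem hasLeading_comp_rot {n : ℕ} {f : UnitAddCircle → ℂ} {z : ℂ} (hf : HasLeading s n f z)
    (k : ℤ) : HasLeading s n (fun x => f (rot α k x))
      (fourier (s * n) (((k * α : ℝ)) : UnitAddCircle) * z) := by
  obtain ⟨P, hP, h⟩ := hf
  set y : UnitAddCircle := ((k * α : ℝ) : UnitAddCircle)
  refine ⟨Polynomial.C (fourier (s * n) y : ℂ) *
    P.comp (Polynomial.C (fourier (-s) y : ℂ) * Polynomial.X), ?_, fun x => ?_⟩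
  · rw [Polynomial.coeff_C_mul, Polynomial.coeff_zero_eq_eval_zero, Polynomial.eval_comp]
    simp [← hP, Polynomial.coeff_zero_eq_eval_zero]
  · beta_reduce
    rw [h, rot, fourier_point_add, fourier_point_add]
    simp only [Polynomial.eval_mul, Polynomial.eval_C, Polynomial.eval_comp, Polynomial.eval_X, y]
    ring_nf

theorem hasLeading_d (hc : ∀ x, c lam α x = a * fourier s x + 1 + b * fourier (-s) x) (n : ℕ) :
    HasLeading s n (d lam α n)
      ((∏ j ∈ Finset.range n, (fourier s (((j : ℝ) * α : ℝ) : UnitAddCircle) : ℂ)) * a ^ n) := by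
  induction n with
  | zero => simpa [funext fun x => show d lam α 0 x = 1 from rfl] using hasLeading_const_zero s 1
  | succ n ih =>
    have h1 : HasLeading s 1 (c lam α) a := by
      have := hasLeading_trinomial s a b
      simpa only [← hc] using this
    have h2 := ih.mul (hasLeading_comp_rot (α := α) h1 n)
    simp only [← d_succ] at h2
    rw [Finset.prod_range_succ]
    convert h2 using 1
    push_cast
    rw [mul_one]
    ring

theorem hasLeading_numer (hc : ∀ x, c lam α x = a * fourier s x + 1 + b * fourier (-s) x)
    (hc' : ∀ x, conj (c lam α (rot α (-1) x)) = b * fourier s x + 1 + a * fourier (-s) x)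
    (E : ℝ) (n : ℕ) (i j : Fin 2) :
    HasLeading s n (fun x => numer lam α E n x i j)
      ((∏ j ∈ Finset.range n, (fourier s (((j : ℝ) * α : ℝ) : UnitAddCircle) : ℂ)) *
        ((!![0, -b; a, 0] : Matrix (Fin 2) (Fin 2) ℂ) ^ n) i j) := by
  induction n generalizing i with
  | zero => simpa [numer] using hasLeading_const_zero s _
  | succ n ih =>
    have h1 : HasLeading s 1 (c lam α) a := by
      have := hasLeading_trinomial s a b
      simpa only [← hc] using this
    have h1' : HasLeading s 1 (fun x => -conj (c lam α (rot α (-1) x))) (-b) := by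
      have := (hasLeading_trinomial s b a).const_mul (-1)
      simpa only [← hc', neg_mul, one_mul] using this
    have h2 := hasLeading_comp_rot (α := α) h1 n
    have h2' := hasLeading_comp_rot (α := α) h1' n
    push_cast at h2 h2'
    rw [mul_one] at h2 h2'
    rw [Finset.prod_range_succ, pow_succ']
    have key (i : Fin 2) {f g : UnitAddCircle → ℂ} {y z : ℂ} (hf : HasLeading s 1 f y)
        (hg : HasLeading s 1 g z) :=
      (hf.mul (ih 0)).add (hg.mul (ih 1))
    fin_cases i
    · have h3 := key 0 (hasLeading_const_one s (E : ℂ)) h2'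
      rw [add_comm 1 n] at h3
      convert h3 using 1
      · funext x
        simp [numer, Matrix.mul_apply, Fin.sum_univ_two]
      · simp [Matrix.mul_apply, Fin.sum_univ_two]
        ring
    · have h3 := key 1 h2 (hasLeading_const_one s 0)
      rw [add_comm 1 n] at h3
      convert h3 using 1
      · funext x
        simp [numer, Matrix.mul_apply, Fin.sum_univ_two]
      · simp [Matrix.mul_apply, Fin.sum_univ_two]
        ring

end Leading

theorem measurePreserving_rot (α : ℝ) (k : ℤ) :
    MeasurePreserving (rot α k) AddCircle.haarAddCircle AddCircle.haarAddCircle :=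
  measurePreserving_add_right _ _

theorem ae_forall_rot {p : UnitAddCircle → Prop} (α : ℝ)
    (h : ∀ᵐ x : UnitAddCircle ∂AddCircle.haarAddCircle, p x) :
    ∀ᵐ x : UnitAddCircle ∂AddCircle.haarAddCircle, ∀ k : ℤ, p (rot α k x) :=
  ae_all_iff.mpr fun k => (measurePreserving_rot α k).quasiMeasurePreserving.ae h

theorem norm_fourierCoeff_Psi {l1 l3 : ℝ} (hl : 1 ≤ l1 + l3) {α : ℝ} {s : ℤ} (hs : s ≠ 0) {a b : ℂ}
    (hc : ∀ x, c (dual l1 l3) α x = a * fourier s x + 1 + b * fourier (-s) x)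
    (hc' : ∀ x, conj (c (dual l1 l3) α (rot α (-1) x)) =
      b * fourier s x + 1 + a * fourier (-s) x) (E : ℝ) (θ : UnitAddCircle) (n : ℕ) :
    ‖fourierCoeff (Psi (dual l1 l3) α E θ n) (s * n)‖ =
      ‖((!![0, -b; a, 0] : Matrix (Fin 2) (Fin 2) ℂ) ^ n).trace -
        a ^ n * (fourier n θ + fourier (-n) θ)‖ := by
  set ph := ∏ j ∈ Finset.range n, (fourier s (((j : ℝ) * α : ℝ) : UnitAddCircle) : ℂ) with hph
  have hphn : ‖ph‖ = 1 := by
    rw [hph, norm_prod]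
    exact Finset.prod_eq_one fun j _ => norm_fourier_apply _ _
  have h1 := ((hasLeading_numer hc hc' E n 0 0).add (hasLeading_numer hc hc' E n 1 1)).add
    ((hasLeading_d hc n).const_mul (-(fourier n θ + fourier (-n) θ)))
  have h2 : Psi (dual l1 l3) α E θ n =ᵐ[AddCircle.haarAddCircle] fun x =>
      numer (dual l1 l3) α E n x 0 0 + numer (dual l1 l3) α E n x 1 1 +
        -(fourier n θ + fourier (-n) θ) * d (dual l1 l3) α n x := by
    filter_upwards [ae_forall_rot α (ae_c_dual_ne_zero hl α)] with x hx
    rw [Psi, smul_sub, d_smul_iter _ _ _ _ _ hx, Matrix.trace_sub, Matrix.trace_smul, R_pow_trace,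
      Matrix.trace_fin_two, smul_eq_mul]
    ring
  rw [fourierCoeff_congr_ae h2, h1.fourierCoeff_eq hs, ← hph, Matrix.trace_fin_two]
  have e1 : ∀ M00 M11 t : ℂ, ph * M00 + ph * M11 + -t * (ph * a ^ n) =
      ph * (M00 + M11 - a ^ n * t) := by
    intros
    ring
  rw [e1, norm_mul, hphn, one_mul]

theorem trace_antidiagonal_pow (a b : ℂ) (k : ℕ) :
    ((!![0, -b; a, 0] : Matrix (Fin 2) (Fin 2) ℂ) ^ (2 * k)).trace = 2 * (-(a * b)) ^ k := by
  have h : (!![0, -b; a, 0] : Matrix (Fin 2) (Fin 2) ℂ) ^ 2 = (-(a * b)) • 1 := by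
    rw [pow_two, Matrix.mul_fin_two, Matrix.one_fin_two]
    simp [mul_comm]
  rw [pow_mul, h, smul_pow, one_pow, Matrix.trace_smul, Matrix.trace_one]
  simp [mul_comm]

theorem boundaryCoeff_two_mul {l1 l3 : ℝ} (hl : 1 ≤ l1 + l3) {α : ℝ} {s : ℤ} (hs : s ≠ 0)
    {a b : ℂ} (ha : ‖a‖ = max l1 l3)
    (hc : ∀ x, c (dual l1 l3) α x = a * fourier s x + 1 + b * fourier (-s) x)
    (hc' : ∀ x, conj (c (dual l1 l3) α (rot α (-1) x)) =
      b * fourier s x + 1 + a * fourier (-s) x) (E : ℝ) (θ : UnitAddCircle) (k : ℕ) :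
    boundaryCoeff (dual l1 l3) α E θ s (2 * k) =
      ‖2 * (-(b / a)) ^ k - (fourier (2 * k : ℕ) θ + fourier (-(2 * k : ℕ)) θ)‖ := by
  have hA := max_pos_of_one_le_add hl
  have ha0 : a ≠ 0 := norm_pos_iff.mp (ha ▸ hA)
  rw [boundaryCoeff, norm_fourierCoeff_Psi hl hs hc hc', trace_antidiagonal_pow, Real.exp_neg,
    exp_mul_I_dual hl, ← ha, ← norm_pow, ← norm_inv, ← norm_mul]
  congr 1
  have e1 : (-(a * b)) ^ k = a ^ (2 * k) * (-(b / a)) ^ k := by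
    rw [pow_mul, ← mul_pow]
    congr 1
    field_simp
  rw [e1]
  field_simp

/-- The two expansions of the dual sampling function used at the two boundary frequencies. -/
theorem c_dual_expansion (l1 l3 α : ℝ) (x : UnitAddCircle) :
    c (dual l1 l3) α x = (l1 * e (α / 2)) * fourier 1 x + 1 + (l3 * e (-(α / 2))) * fourier (-1) x ∧
    conj (c (dual l1 l3) α (rot α (-1) x)) =
      (l3 * e (-(α / 2))) * fourier 1 x + 1 + (l1 * e (α / 2)) * fourier (-1) x := by
  have h1 : ∀ y : UnitAddCircle, c (dual l1 l3) α y =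
      (l1 * e (α / 2)) * fourier 1 y + 1 + (l3 * e (-(α / 2))) * fourier (-1) y := by
    intro y
    rw [c_dual, fourier_point_add, fourier_one_coe, map_mul, conj_e, fourier_neg_one_eq_conj]
    ring
  refine ⟨h1 x, ?_⟩
  rw [h1, fourier_neg_one_eq_conj, fourier_one_rot, fourier_neg_one_eq_conj]
  simp only [map_add, map_mul, map_one, Complex.conj_ofReal, conj_e, Complex.conj_conj]
  have e1 : e (-(α / 2)) * e (-((-1 : ℤ) * α)) = e (α / 2) := by
    rw [← e_add]
    congr 1
    push_cast
    ring
  have e2 : e (- -(α / 2)) * e (- -((-1 : ℤ) * α)) = e (-(α / 2)) := by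
    rw [← e_add]
    congr 1
    push_cast
    ring
  linear_combination (l1 * conj (fourier 1 x : ℂ)) * e1 + (l3 * (fourier 1 x : ℂ)) * e2

theorem exists_boundaryCoeff_eq {l1 l3 : ℝ} (hl : 1 ≤ l1 + l3) (α : ℝ) {s : ℤ}
    (h : (s = 1 ∧ l3 ≤ l1) ∨ (s = -1 ∧ l1 ≤ l3)) :
    ∃ ρ : ℂ, ‖ρ‖ ≤ 1 ∧ ∀ (E : ℝ) (θ : UnitAddCircle) (k : ℕ),
      boundaryCoeff (dual l1 l3) α E θ s (2 * k) =
        ‖2 * ρ ^ k - (fourier (2 * k : ℕ) θ + fourier (-(2 * k : ℕ)) θ)‖ := by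
  have hn (l t : ℝ) : ‖(l : ℂ) * e t‖ = |l| := by
    rw [norm_mul, norm_e, mul_one, Complex.norm_real, Real.norm_eq_abs]
  rcases h with ⟨rfl, h⟩ | ⟨rfl, h⟩
  · refine ⟨_, ?_, boundaryCoeff_two_mul hl one_ne_zero (a := l1 * e (α / 2))
      (b := l3 * e (-(α / 2))) ?_ (fun x => (c_dual_expansion l1 l3 α x).1)
      (fun x => (c_dual_expansion l1 l3 α x).2)⟩
    · rw [norm_neg, norm_div, hn, hn, abs_of_pos (show 0 < l1 by linarith)]
      refine div_le_one_of_le₀ ?_ (by linarith)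
      rw [abs_le]
      constructor <;> linarith
    · rw [hn, max_eq_left h, abs_of_pos (by linarith)]
  · refine ⟨_, ?_, boundaryCoeff_two_mul hl (by norm_num) (a := l3 * e (-(α / 2)))
      (b := l1 * e (α / 2)) ?_ (fun x => ?_) (fun x => ?_)⟩
    · rw [norm_neg, norm_div, hn, hn, abs_of_pos (show 0 < l3 by linarith)]
      refine div_le_one_of_le₀ ?_ (by linarith)
      rw [abs_le]
      constructor <;> linarith
    · rw [hn, max_eq_right h, abs_of_pos (by linarith)]
    · rw [(c_dual_expansion l1 l3 α x).1, neg_neg]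
      ring
    · rw [(c_dual_expansion l1 l3 α x).2, neg_neg]
      ring

/-! ### Non-convergence along a sequence of characters -/

theorem tendsto_fourierCoeff_cofinite {f : UnitAddCircle → ℂ}
    (hf : MemLp f 2 AddCircle.haarAddCircle) : Tendsto (fourierCoeff f) cofinite (nhds 0) := by
  have h := (hasSum_sq_fourierCoeff hf.toLp).summable.tendsto_cofinite_zero
  have h2 := h.sqrt
  simp only [Real.sqrt_zero, Real.sqrt_sq (norm_nonneg _)] at h2
  rw [tendsto_zero_iff_norm_tendsto_zero]
  refine h2.congr fun n => ?_
  rw [fourierCoeff_congr_ae hf.coeFn_toLp]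

theorem measurableSet_tendsto_const {f : ℕ → UnitAddCircle → ℂ} (hf : ∀ l, Continuous (f l))
    (κ : ℂ) : MeasurableSet {θ | Tendsto (fun l => f l θ) atTop (nhds κ)} :=
  measurableSet_tendsto _ fun l => (hf l).measurable

theorem ae_not_tendsto_fourier {k : ℕ → ℕ} (hk : Tendsto k atTop atTop) {κ : ℂ} (hκ : κ ≠ 0) :
    ∀ᵐ θ : UnitAddCircle ∂AddCircle.haarAddCircle,
      ¬ Tendsto (fun l => (fourier (k l) θ + fourier (-(k l)) θ : ℂ)) atTop (nhds κ) := by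
  set S := {θ : UnitAddCircle |
    Tendsto (fun l => (fourier (k l) θ + fourier (-(k l)) θ : ℂ)) atTop (nhds κ)} with hS
  have hSm : MeasurableSet S := measurableSet_tendsto_const
    (fun l => by fun_prop) κ
  have h1 : Tendsto (fun l => ∫ θ in S, (fourier (k l) θ + fourier (-(k l)) θ : ℂ)
      ∂AddCircle.haarAddCircle) atTop (nhds (∫ _ in S, κ ∂AddCircle.haarAddCircle)) := by
    refine tendsto_integral_of_dominated_convergence (fun _ => 2) (fun l => ?_)
      (integrable_const _) (fun l => ?_) ?_
    · exact Continuous.aestronglyMeasurable (by fun_prop)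
    · refine Eventually.of_forall fun θ => ?_
      refine (norm_add_le _ _).trans ?_
      rw [norm_fourier_apply, norm_fourier_apply]
      norm_num
    · filter_upwards [ae_restrict_mem hSm] with θ hθ
      exact hθ
  have hmem : MemLp (S.indicator fun _ => (1 : ℂ)) 2 AddCircle.haarAddCircle :=
    memLp_indicator_const 2 hSm 1 (Or.inr (measure_ne_top _ _))
  have h2 := tendsto_fourierCoeff_cofinite hmem
  have h3 (n : ℤ) : fourierCoeff (S.indicator fun _ => (1 : ℂ)) n =
      ∫ θ in S, (fourier (-n) θ : ℂ) ∂AddCircle.haarAddCircle := by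
    rw [fourierCoeff, ← integral_indicator hSm]
    congr 1
    funext θ
    by_cases h : θ ∈ S <;> simp [h]
  have hcast : Tendsto (fun l => ((k l : ℕ) : ℤ)) atTop atTop :=
    tendsto_natCast_atTop_atTop.comp hk
  have h4 := (h2.comp ((hcast.mono_right atTop_le_cofinite))).add
    (h2.comp ((tendsto_neg_atTop_atBot.comp hcast).mono_right atBot_le_cofinite))
  have h5 := tendsto_nhds_unique h1 ((h4.congr fun l => by
    simp only [Function.comp, h3, neg_neg]
    rw [← integral_add (integrable_fourier _).integrableOn (integrable_fourier _).integrableOn]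
    simp only [add_comm]))
  rw [setIntegral_const, add_zero, smul_eq_zero, or_iff_left hκ, measureReal_eq_zero_iff] at h5
  rw [ae_iff]
  simpa only [not_not] using h5

theorem tendsto_fourier_of_tendsto {k : ℕ → ℕ} (hk : Tendsto k atTop atTop) {ρ : ℂ}
    (hρ : ‖ρ‖ ≤ 1) {θ : UnitAddCircle}
    (h : Tendsto (fun l => ‖2 * ρ ^ (k l) - (fourier (2 * k l : ℕ) θ +
      fourier (-(2 * k l : ℕ)) θ)‖) atTop (nhds 0)) :
    ∃ κ : ℂ, (κ = 2 ∨ κ = -2) ∧ Tendsto (fun l => (fourier (4 * k l : ℕ) θ +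
      fourier (-(4 * k l : ℕ)) θ : ℂ)) atTop (nhds κ) := by
  set τ : ℕ → ℂ := fun l => fourier (2 * k l : ℕ) θ + fourier (-(2 * k l : ℕ)) θ with hτ
  obtain ⟨κ, hκ, hn⟩ : ∃ κ : ℝ, (κ = 2 ∨ κ = 0) ∧
      Tendsto (fun l => ‖2 * ρ ^ (k l)‖) atTop (nhds κ) := by
    rcases hρ.lt_or_eq with h1 | h1
    · refine ⟨0, Or.inr rfl, ?_⟩
      have h2 := ((tendsto_pow_atTop_nhds_zero_of_norm_lt_one h1).comp hk).const_mul 2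
      simpa using h2.norm
    · refine ⟨2, Or.inl rfl, ?_⟩
      simp [h1]
  have hτn : Tendsto (fun l => ‖τ l‖) atTop (nhds κ) := by
    have h2 : Tendsto (fun l => ‖τ l‖ - ‖2 * ρ ^ (k l)‖) atTop (nhds 0) := by
      refine squeeze_zero_norm (fun l => ?_) h
      rw [Real.norm_eq_abs, abs_sub_comm]
      exact abs_norm_sub_norm_le _ _
    simpa using h2.add hn
  have hreal (l : ℕ) : ((‖τ l‖ ^ 2 : ℝ) : ℂ) =
      fourier (4 * k l : ℕ) θ + fourier (-(4 * k l : ℕ)) θ + 2 := by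
    have h3 : conj (τ l) = τ l := by
      simp only [hτ, map_add, fourier_neg, Complex.conj_conj]
      ring
    rw [Complex.ofReal_pow, ← Complex.mul_conj', h3]
    have e1 : ((4 * k l : ℕ) : ℤ) = ((2 * k l : ℕ) : ℤ) + ((2 * k l : ℕ) : ℤ) := by
      push_cast
      ring
    rw [e1, neg_add, fourier_add, fourier_add]
    have := fourier_mul_fourier_neg ((2 * k l : ℕ) : ℤ) θ
    simp only [hτ]
    linear_combination 2 * this
  have h4 : Tendsto (fun l => (((‖τ l‖ ^ 2 : ℝ) : ℂ) - 2)) atTop (nhds (((κ ^ 2 : ℝ) : ℂ) - 2)) :=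
    ((Complex.continuous_ofReal.tendsto _).comp (hτn.pow 2)).sub_const 2
  refine ⟨((κ ^ 2 : ℝ) : ℂ) - 2, ?_, h4.congr fun l => by rw [hreal]; ring⟩
  rcases hκ with rfl | rfl
  · left
    norm_num
  · right
    norm_num

theorem ae_not_tendsto_zero {k : ℕ → ℕ} (hk : Tendsto k atTop atTop) {ρ : ℂ} (hρ : ‖ρ‖ ≤ 1) :
    ∀ᵐ θ : UnitAddCircle ∂AddCircle.haarAddCircle,
      ¬ Tendsto (fun l => ‖2 * ρ ^ (k l) - (fourier (2 * k l : ℕ) θ +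
        fourier (-(2 * k l : ℕ)) θ)‖) atTop (nhds 0) := by
  have hk4 : Tendsto (fun l => 4 * k l) atTop atTop := hk.const_mul_atTop' (by norm_num)
  filter_upwards [ae_not_tendsto_fourier hk4 (two_ne_zero),
    ae_not_tendsto_fourier hk4 (neg_ne_zero.mpr two_ne_zero)] with θ h1 h2 h
  obtain ⟨κ, rfl | rfl, h3⟩ := tendsto_fourier_of_tendsto hk hρ h
  · exact h1 h3
  · exact h2 h3

theorem boundaryCoeff_nonneg (lam : Coupling) (α E : ℝ) (θ : UnitAddCircle) (s : ℤ) (n : ℕ) :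
    0 ≤ boundaryCoeff lam α E θ s n := mul_nonneg (Real.exp_pos _).le (norm_nonneg _)

theorem tendsto_zero_of_limsup_nonpos {f : ℕ → ℝ} (hf : ∀ n, 0 ≤ f n)
    (h : limsup (fun n => (f n : EReal)) atTop ≤ 0) : Tendsto f atTop (nhds 0) := by
  have h1 : (0 : EReal) ≤ liminf (fun n => (f n : EReal)) atTop :=
    le_liminf_of_le (by isBoundedDefault)
      (Eventually.of_forall fun n => EReal.coe_nonneg.mpr (hf n))
  have h2 := tendsto_of_le_liminf_of_limsup_le h1 h
  exact EReal.tendsto_coe.mp h2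

theorem ae_limsup_boundaryCoeff_pos {α : ℝ} (hα : Irrational α) {l1 l3 : ℝ} (hl : 1 ≤ l1 + l3)
    {s : ℤ} (h : (s = 1 ∧ l3 ≤ l1) ∨ (s = -1 ∧ l1 ≤ l3)) {n : ℕ → ℕ} (hn : StrictMono n) :
    ∀ᵐ θ : UnitAddCircle ∂AddCircle.haarAddCircle, ∀ E : ℝ,
      0 < limsup (fun l : ℕ => ((boundaryCoeff (dual l1 l3) α E θ s (m α n l) : ℝ) : EReal))
        atTop := by
  obtain ⟨ρ, hρ, hb⟩ := exists_boundaryCoeff_eq hl α h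
  filter_upwards [ae_not_tendsto_zero ((tendsto_q_atTop hα).comp hn.tendsto_atTop) hρ]
    with θ hθ E
  by_contra hlt
  have h1 := tendsto_zero_of_limsup_nonpos (fun l => boundaryCoeff_nonneg _ _ _ _ _ _)
    (not_lt.mp hlt)
  have h2 : Tendsto (fun l : ℕ => 2 * l + 1) atTop atTop :=
    tendsto_atTop_mono (fun l => by simp only [id]; omega) tendsto_id
  refine hθ ((h1.comp h2).congr fun l => ?_)
  have h3 : m α n (2 * l + 1) = 2 * q α (n l) := by
    rw [m, concat, if_neg (by simp), show (2 * l + 1) / 2 = l by omega]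
  simp only [Function.comp, h3, hb]

/-! ### The rotation -/

theorem rot_rot (α : ℝ) (j k : ℤ) (x : UnitAddCircle) : rot α j (rot α k x) = rot α (k + j) x := by
  simp only [rot, add_assoc, ← AddCircle.coe_add]
  congr 2
  push_cast
  ring

theorem rot_zero (α : ℝ) (x : UnitAddCircle) : rot α 0 x = x := by simp [rot]

theorem rot_neg (α : ℝ) (k : ℤ) (x : UnitAddCircle) : rot α k (-x) = -rot α (-k) x := by
  simp only [rot, neg_add, ← AddCircle.coe_neg]
  congr 2
  push_cast
  ring

theorem ergodic_rot {α : ℝ} (hα : Irrational α) :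
    Ergodic (rot α 1) (AddCircle.haarAddCircle : Measure UnitAddCircle) := by
  rw [haarAddCircle_eq_volume]
  refine AddCircle.ergodic_add_right.mpr (addOrderOf_eq_zero_iff'.mpr fun n hn h => ?_)
  rw [← AddCircle.coe_nsmul, AddCircle.coe_eq_zero_iff] at h
  obtain ⟨k, hk⟩ := h
  have h1 : (n : ℝ) * α = k := by simpa using hk.symm
  exact (hα.natCast_mul hn.ne').ne_int k h1

/-! ### Fourier coefficients of square integrable functions -/

theorem fourierCoeff_add_apply {f g : UnitAddCircle → ℂ} (hf : MemLp f 2 AddCircle.haarAddCircle)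
    (hg : MemLp g 2 AddCircle.haarAddCircle) (k : ℤ) :
    fourierCoeff (fun x => f x + g x) k = fourierCoeff f k + fourierCoeff g k :=
  congrFun (fourierCoeff.add (hf.integrable one_le_two) (hg.integrable one_le_two)) k

theorem fourierCoeff_comp_add_right (f : UnitAddCircle → ℂ) (y : UnitAddCircle) (k : ℤ) :
    fourierCoeff (fun x => f (x + y)) k = fourier k y * fourierCoeff f k := by
  rw [fourierCoeff, fourierCoeff,
    ← integral_add_right_eq_self (fun x : UnitAddCircle => fourier (-k) x • f x) y,
    ← integral_const_mul]
  congr 1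
  funext x
  rw [fourier_point_add, smul_eq_mul, smul_eq_mul]
  linear_combination (-(fourier (-k) x : ℂ) * f (x + y)) * fourier_mul_fourier_neg k y

theorem fourierCoeff_fourier_mul (f : UnitAddCircle → ℂ) (n k : ℤ) :
    fourierCoeff (fun x => fourier n x * f x) k = fourierCoeff f (k - n) := by
  rw [fourierCoeff, fourierCoeff]
  congr 1
  funext x
  rw [smul_eq_mul, smul_eq_mul, ← mul_assoc, ← fourier_add]
  congr 3
  ring

theorem ae_eq_of_fourierCoeff_eq {f g : UnitAddCircle → ℂ}
    (hf : MemLp f 2 AddCircle.haarAddCircle) (hg : MemLp g 2 AddCircle.haarAddCircle)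
    (h : ∀ k, fourierCoeff f k = fourierCoeff g k) : f =ᵐ[AddCircle.haarAddCircle] g := by
  rw [← MemLp.toLp_eq_toLp_iff hf hg]
  apply fourierBasis.repr.injective
  ext k
  rw [fourierBasis_repr, fourierBasis_repr, fourierCoeff_congr_ae hf.coeFn_toLp,
    fourierCoeff_congr_ae hg.coeFn_toLp, h]

theorem memLp_fourier_mul {f : UnitAddCircle → ℂ} (hf : MemLp f 2 AddCircle.haarAddCircle)
    (n : ℤ) : MemLp (fun x => fourier n x * f x) 2 AddCircle.haarAddCircle := by
  refine hf.of_le_mul (c := 1) ?_ (Eventually.of_forall fun x => ?_)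
  · exact (Continuous.aestronglyMeasurable (by fun_prop)).mul hf.1
  · rw [norm_mul, norm_fourier_apply]

theorem memLp_comp_rot {f : UnitAddCircle → ℂ} (hf : MemLp f 2 AddCircle.haarAddCircle) (α : ℝ)
    (j : ℤ) : MemLp (fun x => f (rot α j x)) 2 AddCircle.haarAddCircle :=
  hf.comp_measurePreserving (measurePreserving_rot α j)

theorem fourier_coe (k : ℤ) (y : ℝ) : (fourier k ((y : ℝ) : UnitAddCircle) : ℂ) = e (k * y) := by
  rw [fourier_coe_apply, e]
  congr 1
  push_cast
  ring

theorem fourierCoeff_comp_rot (f : UnitAddCircle → ℂ) (α : ℝ) (j k : ℤ) :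
    fourierCoeff (fun x => f (rot α j x)) k = e (k * (j * α)) * fourierCoeff f k := by
  rw [← fourier_coe]
  exact fourierCoeff_comp_add_right f _ k

/-- `(a e^{2πix} + 1 + b e^{-2πix}) f(x + jα)` is square integrable, with the obvious Fourier
coefficients. -/
theorem fourierCoeff_trinomial_mul {f : UnitAddCircle → ℂ} (hf : MemLp f 2 AddCircle.haarAddCircle)
    (α : ℝ) (j : ℤ) (a b : ℂ) :
    MemLp (fun x => (a * fourier 1 x + 1 + b * fourier (-1) x) * f (rot α j x)) 2
      AddCircle.haarAddCircle ∧
    ∀ k : ℤ, fourierCoeff (fun x => (a * fourier 1 x + 1 + b * fourier (-1) x) * f (rot α j x)) k =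
      a * (e ((k - 1 : ℤ) * (j * α)) * fourierCoeff f (k - 1)) + e (k * (j * α)) * fourierCoeff f k +
      b * (e ((k + 1 : ℤ) * (j * α)) * fourierCoeff f (k + 1)) := by
  have hr := memLp_comp_rot hf α j
  have h1 := (memLp_fourier_mul hr 1).const_mul a
  have h2 := (memLp_fourier_mul hr (-1)).const_mul b
  have e1 : (fun x => (a * fourier 1 x + 1 + b * fourier (-1) x) * f (rot α j x)) = fun x =>
      (a * (fourier 1 x * f (rot α j x)) + f (rot α j x)) +
        b * (fourier (-1) x * f (rot α j x)) := by
    funext x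
    ring
  rw [e1]
  refine ⟨(h1.add hr).add h2, fun k => ?_⟩
  have h3 : fourierCoeff (fun x => a * (fourier 1 x * f (rot α j x)) + f (rot α j x) +
      b * (fourier (-1) x * f (rot α j x))) k =
      fourierCoeff (fun x => a * (fourier 1 x * f (rot α j x)) + f (rot α j x)) k +
      fourierCoeff (fun x => b * (fourier (-1) x * f (rot α j x))) k :=
    fourierCoeff_add_apply (h1.add hr) h2 k
  rw [h3, fourierCoeff_add_apply h1 hr, fourierCoeff.const_mul, fourierCoeff.const_mul, fourierCoeff_fourier_mul, fourierCoeff_fourier_mul,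
    fourierCoeff_comp_rot, fourierCoeff_comp_rot, fourierCoeff_comp_rot, sub_neg_eq_add]

/-! ### Aubry duality -/

/-- The equation satisfied by the Fourier series of an eigenfunction. -/
def IsDualSolution (lam : Coupling) (α E : ℝ) (t t' : ℂ) (u : UnitAddCircle → ℂ) : Prop :=
  ∀ᵐ x : UnitAddCircle ∂AddCircle.haarAddCircle, E * u x =
    t * c lam α x * u (rot α 1 x) + t' * conj (c lam α (rot α (-1) x)) * u (rot α (-1) x)

theorem isDualSolution_of_jacobi {l1 l3 α E : ℝ} {θ : UnitAddCircle} {u : UnitAddCircle → ℂ}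
    (hu : MemLp u 2 AddCircle.haarAddCircle)
    (h : ∀ k, jacobi ⟨l1, 0, l3⟩ α θ (fourierCoeff u) k = E * fourierCoeff u k) :
    IsDualSolution (dual l1 l3) α E (fourier 1 θ) (fourier (-1) θ) u := by
  obtain ⟨m1, c1⟩ := fourierCoeff_trinomial_mul hu α 1 (l1 * e (α / 2)) (l3 * e (-(α / 2)))
  obtain ⟨m2, c2⟩ := fourierCoeff_trinomial_mul hu α (-1) (l3 * e (-(α / 2))) (l1 * e (α / 2))
  have key := ae_eq_of_fourierCoeff_eq (hu.const_mul (E : ℂ))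
    ((m1.const_mul (fourier 1 θ : ℂ)).add (m2.const_mul (fourier (-1) θ : ℂ))) (fun k => by
      have h1 := fourierCoeff_add_apply (m1.const_mul (fourier 1 θ : ℂ))
        (m2.const_mul (fourier (-1) θ : ℂ)) k
      refine Eq.trans ?_ h1.symm
      rw [fourierCoeff.const_mul, fourierCoeff.const_mul, fourierCoeff.const_mul, c1, c2, ← h k]
      have hn (y : ℝ) : (fourier (-1) ((y : ℝ) : UnitAddCircle) : ℂ) = e (-y) := by
        rw [fourier_coe]
        congr 1
        push_cast
        ring
      have hconj (y : UnitAddCircle) : conj (fourier (-1) y : ℂ) = fourier 1 y := by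
        rw [fourier_neg_one_eq_conj, Complex.conj_conj]
      have hhh : e (α / 2) * e (-(α / 2)) = 1 := by
        rw [← e_add, add_neg_cancel, e_zero]
      have p1 : e (((k - 1 : ℤ) : ℝ) * α) = e (k * α) * e (-(α / 2)) * e (-(α / 2)) := by
        rw [← e_add, ← e_add]
        congr 1
        push_cast
        ring
      have p2 : e (-(((k - 1 : ℤ) : ℝ) * α)) = e (-(k * α)) * e (α / 2) * e (α / 2) := by
        rw [← e_add, ← e_add]
        congr 1
        push_cast
        ring
      have p3 : e (((k + 1 : ℤ) : ℝ) * α) = e (k * α) * e (α / 2) * e (α / 2) := by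
        rw [← e_add, ← e_add]
        congr 1
        push_cast
        ring
      have p4 : e (-(((k + 1 : ℤ) : ℝ) * α)) = e (-(k * α)) * e (-(α / 2)) * e (-(α / 2)) := by
        rw [← e_add, ← e_add]
        congr 1
        push_cast
        ring
      simp only [jacobi, v, c, rot, fourier_point_add, fourier_one_coe, hn, map_add, map_mul,
        Complex.conj_ofReal, conj_e, neg_neg, hconj, ← fourier_neg_one_eq_conj, Int.cast_one, one_mul, Int.cast_neg,
        mul_neg, neg_mul, p1, p2, p3, p4, Complex.ofReal_zero, add_zero]
      linear_combination (-l3 * (fourier 1 θ : ℂ) * e (k * α) * e (α / 2) * fourierCoeff u (k + 1)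
        - l1 * (fourier (-1) θ : ℂ) * e (-(k * α)) * e (-(α / 2)) * fourierCoeff u (k + 1)) * hhh)
  filter_upwards [key] with x hx
  have hx' : E * u x = fourier 1 θ * ((l1 * e (α / 2) * fourier 1 x + 1 +
      l3 * e (-(α / 2)) * fourier (-1) x) * u (rot α 1 x)) + fourier (-1) θ *
      ((l3 * e (-(α / 2)) * fourier 1 x + 1 + l1 * e (α / 2) * fourier (-1) x) *
        u (rot α (-1) x)) := hx
  rw [hx', (c_dual_expansion l1 l3 α x).1, (c_dual_expansion l1 l3 α x).2]
  ring

theorem IsDualSolution.comp_neg {l1 l3 α E : ℝ} {t t' : ℂ} {u : UnitAddCircle → ℂ}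
    (h : IsDualSolution (dual l1 l3) α E t t' u) :
    IsDualSolution (dual l1 l3) α E t' t (fun x => u (-x)) := by
  have hneg : MeasurePreserving (fun x : UnitAddCircle => -x) AddCircle.haarAddCircle
      AddCircle.haarAddCircle := Measure.measurePreserving_neg _
  have h1 (x : UnitAddCircle) : c (dual l1 l3) α (-x) = conj (c (dual l1 l3) α (rot α (-1) x)) := by
    rw [(c_dual_expansion l1 l3 α (-x)).1, (c_dual_expansion l1 l3 α x).2]
    simp only [fourier_apply, neg_smul, one_smul, neg_neg]
    ring
  filter_upwards [hneg.quasiMeasurePreserving.ae h] with x hx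
  have h2 : conj (c (dual l1 l3) α (rot α (-1) (-x))) = c (dual l1 l3) α x := by
    rw [← h1, neg_neg]
  rw [h2, h1, rot_neg, rot_neg, neg_neg] at hx
  linear_combination hx

/-! ### Eigenvalues are real -/

theorem conj_v (θ : UnitAddCircle) : conj (v θ) = v θ := by
  rw [v, map_add, fourier_neg_one_eq_conj, Complex.conj_conj, add_comm]

theorem summable_conj_mul {f g : ℤ → ℂ} (hf : Memℓp f 2) (hg : Memℓp g 2) :
    Summable fun k => conj (f k) * g k := by
  have := lp.summable_inner (𝕜 := ℂ) (⟨f, hf⟩ : lp (fun _ : ℤ => ℂ) 2) ⟨g, hg⟩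
  simpa only [RCLike.inner_apply, mul_comm] using this

theorem conj_eq_of_jacobi_eq {lam : Coupling} {α : ℝ} {θ : UnitAddCircle} {ψ : ℤ → ℂ}
    (hψ : Memℓp ψ 2) (h0 : ψ ≠ 0) {E : ℂ} (h : ∀ k, jacobi lam α θ ψ k = E * ψ k) : conj E = E := by
  set s : ℤ → ℂ := fun k => conj (ψ k) * (c lam α (rot α k θ) * ψ (k + 1)) with hs
  have hs1 : Summable s := summable_conj_mul hψ
    (memℓp_mul_shift hψ (fun k => c lam α (rot α k θ)) _ (fun k => norm_c_le lam α _) 1)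
  have hs2 : Summable fun k => conj (ψ k) * (v (rot α k θ) * ψ (k + 0)) := summable_conj_mul hψ
    (memℓp_mul_shift hψ (fun k => v (rot α k θ)) 2 (fun k => norm_v_le _) 0)
  have hs3 : Summable fun k => conj (ψ k) * ψ k := summable_conj_mul hψ hψ
  have hs4 : Summable fun k => conj (s (k - 1)) :=
    (Complex.summable_conj.mpr hs1).comp_injective (sub_left_injective (b := (1 : ℤ)))
  have hk (k : ℤ) : E * (conj (ψ k) * ψ k) =
      conj (ψ k) * (v (rot α k θ) * ψ (k + 0)) + s k + conj (s (k - 1)) := by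
    have := h k
    simp only [hs, map_mul, Complex.conj_conj, sub_add_cancel, add_zero]
    rw [jacobi] at this
    linear_combination (-conj (ψ k)) * this
  have e1 : ∑' k, conj (s (k - 1)) = conj (∑' k, s k) := by
    rw [Complex.conj_tsum]
    exact (Equiv.subRight (1 : ℤ)).tsum_eq fun k => conj (s k)
  have e2 : conj (∑' k, conj (ψ k) * (v (rot α k θ) * ψ (k + 0))) =
      ∑' k, conj (ψ k) * (v (rot α k θ) * ψ (k + 0)) := by
    rw [Complex.conj_tsum]
    refine tsum_congr fun k => ?_
    simp only [map_mul, Complex.conj_conj, conj_v, add_zero]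
    ring
  have e3 : ∑' k, conj (ψ k) * ψ k = ((∑' k, ‖ψ k‖ ^ 2 : ℝ) : ℂ) := by
    rw [Complex.ofReal_tsum]
    refine tsum_congr fun k => ?_
    rw [Complex.conj_mul']
    push_cast
    rfl
  have hsum : E * ((∑' k, ‖ψ k‖ ^ 2 : ℝ) : ℂ) =
      ∑' k, conj (ψ k) * (v (rot α k θ) * ψ (k + 0)) + ∑' k, s k + conj (∑' k, s k) := by
    rw [← e3, ← tsum_mul_left, ← e1, ← hs2.tsum_add hs1, ← (hs2.add hs1).tsum_add hs4]
    exact tsum_congr hk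
  have hconj := congrArg conj hsum
  simp only [map_add, map_mul, Complex.conj_ofReal, Complex.conj_conj, e2] at hconj
  have hne : ((∑' k, ‖ψ k‖ ^ 2 : ℝ) : ℂ) ≠ 0 := by
    obtain ⟨k, hk⟩ := Function.ne_iff.mp h0
    have hsr : Summable fun k => ‖ψ k‖ ^ 2 := by
      have := hs3.norm
      refine this.congr fun k => ?_
      rw [norm_mul, RCLike.norm_conj, pow_two]
    have : 0 < ∑' k, ‖ψ k‖ ^ 2 :=
      hsr.tsum_pos (fun _ => by positivity) k (by
        have : ‖ψ k‖ ≠ 0 := norm_ne_zero_iff.mpr hk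
        positivity)
    exact_mod_cast this.ne'
  apply mul_right_cancel₀ hne
  rw [hconj, hsum]
  ring

theorem exists_dualSolution_of_mem_pointSpectrum {l1 l3 α : ℝ} {θ : UnitAddCircle} {E : ℂ}
    (hE : E ∈ pointSpectrum (H ⟨l1, 0, l3⟩ α θ)) :
    ∃ (E' : ℝ) (u : UnitAddCircle → ℂ), MemLp u 2 AddCircle.haarAddCircle ∧ Measurable u ∧
      ¬ (u =ᵐ[AddCircle.haarAddCircle] 0) ∧
      IsDualSolution (dual l1 l3) α E' (fourier 1 θ) (fourier (-1) θ) u := by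
  obtain ⟨ψ, hψ⟩ := Module.End.HasEigenvalue.exists_hasEigenvector hE
  have h1 := hψ.apply_eq_smul
  have hj (k : ℤ) : jacobi ⟨l1, 0, l3⟩ α θ ψ k = E * ψ k := by
    have := congrArg (fun f : lp (fun _ : ℤ => ℂ) 2 => f k) h1
    simpa [H] using this
  have hψ0 : (ψ : ℤ → ℂ) ≠ 0 := fun h => hψ.2 (lp.ext h)
  have hreal := conj_eq_of_jacobi_eq (lp.memℓp ψ) hψ0 hj
  obtain ⟨E', rfl⟩ := Complex.conj_eq_iff_real.mp hreal
  set u := (fourierBasis (T := 1)).repr.symm ψ with hu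
  have hcoef : fourierCoeff (u : UnitAddCircle → ℂ) = ψ := by
    funext k
    rw [← fourierBasis_repr, hu, LinearIsometryEquiv.apply_symm_apply]
  refine ⟨E', u, Lp.memLp u, (Lp.stronglyMeasurable u).measurable, fun h => hψ0 ?_,
    isDualSolution_of_jacobi (Lp.memLp u) (by simpa only [hcoef] using hj)⟩
  rw [← hcoef, fourierCoeff_congr_ae h]
  funext k
  simp [fourierCoeff]

/-! ### The Wronskian of two solutions of the dual equation -/

theorem measurable_rot (α : ℝ) (k : ℤ) : Measurable (rot α k) := (measurePreserving_rot α k).measurable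

section Wronskian

variable {lam : Coupling} {α E : ℝ} {t t' : ℂ} {u w : UnitAddCircle → ℂ}

theorem IsDualSolution.ae_ne_zero (hu : IsDualSolution lam α E t t' u) (hα : Irrational α)
    (hum : Measurable u) (hu0 : ¬ (u =ᵐ[AddCircle.haarAddCircle] 0)) (ht : t ≠ 0)
    (hc : ∀ᵐ x : UnitAddCircle ∂AddCircle.haarAddCircle, c lam α x ≠ 0) :
    ∀ᵐ x : UnitAddCircle ∂AddCircle.haarAddCircle, ¬ (u x = 0 ∧ u (rot α (-1) x) = 0) := by
  set Z : Set UnitAddCircle := {x | u x = 0 ∧ u (rot α (-1) x) = 0} with hZ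
  have hZm : MeasurableSet Z := (hum (measurableSet_singleton 0)).inter
    ((hum.comp (measurable_rot α (-1))) (measurableSet_singleton 0))
  have hsub : Z ≤ᵐ[AddCircle.haarAddCircle] rot α 1 ⁻¹' Z := by
    filter_upwards [hu, hc] with x hx hcx hxZ
    obtain ⟨h1, h2⟩ : u x = 0 ∧ u (rot α (-1) x) = 0 := hxZ
    rw [h1, h2, mul_zero, mul_zero, add_zero, eq_comm, mul_eq_zero, mul_eq_zero] at hx
    have h3 : u (rot α 1 x) = 0 := by
      rcases hx with (h | h) | h
      · exact absurd h ht
      · exact absurd h hcx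
      · exact h
    refine ⟨h3, ?_⟩
    rw [rot_rot, add_neg_cancel, rot_zero]
    exact h1
  rcases (ergodic_rot hα).ae_empty_or_univ_of_ae_le_preimage hZm.nullMeasurableSet hsub with h | h
  · rw [ae_eq_empty] at h
    rw [ae_iff]
    simpa [not_not] using h
  · refine absurd ?_ hu0
    filter_upwards [h] with x hx
    have : x ∈ Z := by
      change Z x
      rw [hx]
      trivial
    exact this.1

/-- The Wronskian of `u` and `w` at `x`. -/
def wronskian (α : ℝ) (t t' : ℂ) (u w : UnitAddCircle → ℂ) (x : UnitAddCircle) : ℂ :=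
  t * u x * w (rot α (-1) x) - t' * u (rot α (-1) x) * w x

theorem ae_wronskian_rot (hu : IsDualSolution lam α E t t' u)
    (hw : IsDualSolution lam α E t' t w) :
    ∀ᵐ x : UnitAddCircle ∂AddCircle.haarAddCircle,
      c lam α x * wronskian α t t' u w (rot α 1 x) =
        conj (c lam α (rot α (-1) x)) * wronskian α t t' u w x := by
  filter_upwards [hu, hw] with x h1 h2
  rw [wronskian, wronskian, rot_rot, add_neg_cancel, rot_zero]
  linear_combination u x * h2 - w x * h1

theorem exists_ae_norm_wronskian_eq (hα : Irrational α) (hcm : Measurable (c lam α))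
    (hu : IsDualSolution lam α E t t' u) (hw : IsDualSolution lam α E t' t w)
    (hum : Measurable u) (hwm : Measurable w) :
    ∃ b : ℝ, ∀ᵐ x : UnitAddCircle ∂AddCircle.haarAddCircle,
      ‖c lam α (rot α (-1) x)‖ * ‖wronskian α t t' u w x‖ = b := by
  have hm := measurable_rot α (-1)
  have hmeas : Measurable fun x : UnitAddCircle =>
      ‖c lam α (rot α (-1) x)‖ * ‖wronskian α t t' u w x‖ := by
    unfold wronskian
    exact (hcm.comp hm).norm.mul (((hum.const_mul t).mul (hwm.comp hm)).sub
      (((hum.comp hm).const_mul t').mul hwm)).norm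
  refine (ergodic_rot hα).ae_eq_const_of_ae_eq_comp_ae hmeas.aestronglyMeasurable ?_
  filter_upwards [ae_wronskian_rot hu hw] with x hx
  have h := congrArg norm hx
  rw [norm_mul, norm_mul, RCLike.norm_conj] at h
  simp only [Function.comp, rot_rot, add_neg_cancel, rot_zero]
  exact h

/-- If the Wronskian vanishes, then the two solutions differ by a factor `φ` with
`φ(x + α) = t² φ(x)`. -/
theorem exists_factor_of_wronskian_eq_zero (hα : Irrational α)
    (hc : ∀ᵐ x : UnitAddCircle ∂AddCircle.haarAddCircle, c lam α x ≠ 0)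
    (hu : IsDualSolution lam α E t t' u) (hw : IsDualSolution lam α E t' t w)
    (hum : Measurable u) (hwm : Measurable w) (hu0 : ¬ (u =ᵐ[AddCircle.haarAddCircle] 0))
    (htt : t * t' = 1)
    (hW : ∀ᵐ x : UnitAddCircle ∂AddCircle.haarAddCircle, wronskian α t t' u w x = 0) :
    ∃ φ : UnitAddCircle → ℂ, Measurable φ ∧
      (∀ᵐ x : UnitAddCircle ∂AddCircle.haarAddCircle, w x = φ x * u x) ∧
      ∀ᵐ x : UnitAddCircle ∂AddCircle.haarAddCircle, φ (rot α 1 x) = t ^ 2 * φ x := by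
  have ht : t ≠ 0 := left_ne_zero_of_mul_eq_one htt
  have hm := measurable_rot α (-1)
  set N : UnitAddCircle → ℂ := fun x =>
    conj (u x) * u x + conj (u (rot α (-1) x)) * u (rot α (-1) x) with hN
  set φ : UnitAddCircle → ℂ := fun x => (conj (u x) * w x +
    t ^ 2 * (conj (u (rot α (-1) x)) * w (rot α (-1) x))) / N x with hφ
  have hcm : Measurable fun x => conj (u x) := Complex.continuous_conj.measurable.comp hum
  have hφm : Measurable φ := by
    have hum' := hum.comp hm
    have hwm' := hwm.comp hm
    have hcm' := hcm.comp hm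
    exact ((hcm.mul hwm).add ((hcm'.mul hwm').const_mul _)).div
      ((hcm.mul hum).add (hcm'.mul hum'))
  have hN0 : ∀ᵐ x : UnitAddCircle ∂AddCircle.haarAddCircle, N x ≠ 0 := by
    filter_upwards [hu.ae_ne_zero hα hum hu0 ht hc] with x hx h
    have h1 : N x = ((‖u x‖ ^ 2 + ‖u (rot α (-1) x)‖ ^ 2 : ℝ) : ℂ) := by
      simp only [hN, Complex.conj_mul']
      push_cast
      rfl
    rw [h1] at h
    have h2 : ‖u x‖ ^ 2 + ‖u (rot α (-1) x)‖ ^ 2 = 0 := by exact_mod_cast h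
    have h3 := sq_nonneg ‖u x‖
    have h4 := sq_nonneg ‖u (rot α (-1) x)‖
    refine hx ⟨?_, ?_⟩ <;> rw [← norm_eq_zero, ← sq_eq_zero_iff] <;> linarith
  have key : ∀ᵐ x : UnitAddCircle ∂AddCircle.haarAddCircle, w x = φ x * u x ∧
      t ^ 2 * w (rot α (-1) x) = φ x * u (rot α (-1) x) := by
    filter_upwards [hN0, hW] with x hx hWx
    rw [wronskian] at hWx
    simp only [hφ]
    rw [div_mul_eq_mul_div, div_mul_eq_mul_div, eq_div_iff hx, eq_div_iff hx]
    simp only [hN]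
    constructor
    · linear_combination (-conj (u (rot α (-1) x)) * t) * hWx -
        (conj (u (rot α (-1) x)) * u (rot α (-1) x) * w x) * htt
    · linear_combination (conj (u x) * t) * hWx +
        (conj (u x) * u (rot α (-1) x) * w x) * htt
  refine ⟨φ, hφm, key.mono fun x hx => hx.1, ?_⟩
  filter_upwards [ae_forall_rot α key, ae_forall_rot α hc, hu, hw,
    hu.ae_ne_zero hα hum hu0 ht hc] with x hk hcx h1 h2 h0
  obtain ⟨k1, k2⟩ := hk 1
  have k3 := (hk 0).1
  have k4 := (hk 0).2
  rw [rot_zero] at k3 k4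
  rw [rot_rot, add_neg_cancel, rot_zero] at k2
  by_cases hux : u x = 0
  · have hum1 : u (rot α (-1) x) ≠ 0 := fun h => h0 ⟨hux, h⟩
    have hwx : w x = 0 := by rw [k3, hux, mul_zero]
    rw [hux, mul_zero] at h1
    rw [hwx, mul_zero] at h2
    have hcc : conj (c lam α (rot α (-1) x)) ≠ 0 := (map_ne_zero _).mpr (hcx (-1))
    apply mul_right_cancel₀ (mul_ne_zero hcc hum1)
    linear_combination (-φ (rot α 1 x) * t) * h1 -
      (φ (rot α 1 x) * conj (c lam α (rot α (-1) x)) * u (rot α (-1) x)) * htt +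
      (t ^ 2 * c lam α x) * k1 + t ^ 3 * h2 + (t ^ 2 * c lam α x * w (rot α 1 x)) * htt +
      t ^ 2 * conj (c lam α (rot α (-1) x)) * k4
  · apply mul_right_cancel₀ hux
    linear_combination t ^ 2 * k3 - k2

theorem exists_int_of_factor {φ : UnitAddCircle → ℂ} (hα : Irrational α) (hφm : Measurable φ)
    (ht : ‖t‖ = 1) (hφ0 : ¬ (φ =ᵐ[AddCircle.haarAddCircle] 0))
    (h : ∀ᵐ x : UnitAddCircle ∂AddCircle.haarAddCircle, φ (rot α 1 x) = t ^ 2 * φ x) :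
    ∃ k : ℤ, e (k * α) = t ^ 2 := by
  obtain ⟨M, hM⟩ := (ergodic_rot hα).ae_eq_const_of_ae_eq_comp_ae
    (g := fun x => ‖φ x‖) hφm.norm.aestronglyMeasurable (by
      filter_upwards [h] with x hx
      simp only [Function.comp, hx, norm_mul, norm_pow, ht, one_pow, one_mul])
  have hmem : MemLp φ 2 AddCircle.haarAddCircle :=
    MemLp.of_bound hφm.aestronglyMeasurable M (hM.mono fun x hx => hx.le)
  by_contra hne
  push Not at hne
  refine hφ0 (ae_eq_of_fourierCoeff_eq hmem MemLp.zero' fun k => ?_)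
  have h1 := congrFun (fourierCoeff_congr_ae h) k
  rw [fourierCoeff.const_mul, fourierCoeff_comp_rot, Int.cast_one, one_mul] at h1
  have h2 : (e (k * α) - t ^ 2) * fourierCoeff φ k = 0 := by linear_combination h1
  rw [mul_eq_zero, or_iff_right (sub_ne_zero.mpr (hne k))] at h2
  rw [h2]
  simp [fourierCoeff]

end Wronskian

theorem continuous_c (lam : Coupling) (α : ℝ) : Continuous (c lam α) := by
  unfold c
  fun_prop

theorem ae_comp_neg {p : UnitAddCircle → Prop}
    (h : ∀ᵐ x : UnitAddCircle ∂AddCircle.haarAddCircle, p x) :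
    ∀ᵐ x : UnitAddCircle ∂AddCircle.haarAddCircle, p (-x) :=
  (Measure.measurePreserving_neg _).quasiMeasurePreserving.ae h

/-- For phases which are not `α`-rational the Wronskian of `u(x)` and `u(-x)` is bounded away from
zero, relative to the sampling function. -/
theorem exists_pos_ae_norm_wronskian_eq {l1 l3 α E : ℝ} (hl : 1 ≤ l1 + l3) (hα : Irrational α)
    {θ : UnitAddCircle} (hθ : ¬ IsAlphaRational α θ) {u : UnitAddCircle → ℂ} (hum : Measurable u)
    (hu0 : ¬ (u =ᵐ[AddCircle.haarAddCircle] 0))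
    (hu : IsDualSolution (dual l1 l3) α E (fourier 1 θ) (fourier (-1) θ) u) :
    ∃ b : ℝ, 0 < b ∧ ∀ᵐ x : UnitAddCircle ∂AddCircle.haarAddCircle,
      ‖c (dual l1 l3) α (rot α (-1) x)‖ *
        ‖wronskian α (fourier 1 θ) (fourier (-1) θ) u (fun x => u (-x)) x‖ = b := by
  have hw := hu.comp_neg
  have hwm : Measurable fun x : UnitAddCircle => u (-x) := hum.comp measurable_neg
  have hc := ae_c_dual_ne_zero hl α
  obtain ⟨b, hb⟩ := exists_ae_norm_wronskian_eq hα (continuous_c _ _).measurable hu hw hum hwm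
  refine ⟨b, ?_, hb⟩
  have hb0 : 0 ≤ b := by
    obtain ⟨x, hx⟩ := hb.exists
    rw [← hx]
    positivity
  refine hb0.lt_of_ne fun h0 => hθ ?_
  obtain ⟨φ, hφm, hφ1, hφ2⟩ := exists_factor_of_wronskian_eq_zero hα hc hu hw hum hwm hu0
    (fourier_mul_fourier_neg 1 θ) (by
      filter_upwards [hb, ae_forall_rot α hc] with x hx hcx
      rw [← h0, mul_eq_zero, norm_eq_zero, or_iff_right (hcx (-1)), norm_eq_zero] at hx
      exact hx)
  obtain ⟨k, hk⟩ := exists_int_of_factor hα hφm (norm_fourier_apply 1 θ) (fun h => hu0 (by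
    have h1 : ∀ᵐ x : UnitAddCircle ∂AddCircle.haarAddCircle, u (-x) = 0 := by
      filter_upwards [h, hφ1] with x hx hx1
      rw [hx1, hx, Pi.zero_apply, zero_mul]
    filter_upwards [ae_comp_neg h1] with x hx
    rwa [neg_neg] at hx)) hφ2
  refine ⟨-k, ?_⟩
  have h2 : (fourier 1 (((k : ℝ) * α : ℝ) : UnitAddCircle) : ℂ) = fourier 1 (2 • θ) := by
    rw [fourier_one_coe, hk, two_nsmul, fourier_point_add, pow_two]
  rw [fourier_one, fourier_one] at h2
  have h3 := AddCircle.injective_toCircle one_ne_zero (Subtype.ext h2)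
  rw [rot, ← h3, ← AddCircle.coe_add]
  have h4 : (k : ℝ) * α + ((-k : ℤ) : ℝ) * α = 0 := by
    push_cast
    ring
  rw [h4, AddCircle.coe_zero]

/-! ### Continuity of translations -/

theorem integrable_norm_sub_mul_norm {f g : UnitAddCircle → ℂ}
    (hf : MemLp f 2 AddCircle.haarAddCircle) (hg : MemLp g 2 AddCircle.haarAddCircle)
    (y : UnitAddCircle) :
    Integrable (fun x => ‖f (x + y) - f x‖ * ‖g x‖) AddCircle.haarAddCircle :=
  ((hf.comp_measurePreserving (measurePreserving_add_right _ y)).sub hf).norm.integrable_mul hg.norm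

theorem tendsto_integral_norm_sub_mul_norm {f g : UnitAddCircle → ℂ}
    (hf : MemLp f 2 AddCircle.haarAddCircle) (hg : MemLp g 2 AddCircle.haarAddCircle)
    {y : ℕ → UnitAddCircle} (hy : Tendsto y atTop (nhds 0)) :
    Tendsto (fun l => ∫ x, ‖f (x + y l) - f x‖ * ‖g x‖ ∂AddCircle.haarAddCircle) atTop
      (nhds 0) := by
  have hmp (z : UnitAddCircle) : MeasurePreserving (fun x => x + z) AddCircle.haarAddCircle
      AddCircle.haarAddCircle := measurePreserving_add_right _ z
  let G : C(UnitAddCircle, C(UnitAddCircle, UnitAddCircle)) :=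
    ContinuousMap.curry ⟨fun p : UnitAddCircle × UnitAddCircle => p.2 + p.1, by fun_prop⟩
  have hG := (G.continuous.tendsto 0).comp hy
  have h1 := Filter.Tendsto.compMeasurePreservingLp (p := 2)
    (tendsto_const_nhds (x := hf.toLp f)) hG (fun l => hmp (y l)) (hmp 0) (by norm_num)
  have h2 (z : UnitAddCircle) : Lp.compMeasurePreserving (G z) (hmp z) (hf.toLp f) =
      (hf.comp_measurePreserving (hmp z)).toLp _ := rfl
  have h3 : (hf.comp_measurePreserving (hmp 0)).toLp _ = hf.toLp f := by
    congr 1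
    funext x
    simp
  simp only [Function.comp, h2] at h1
  rw [h3, tendsto_iff_norm_sub_tendsto_zero] at h1
  have hd (l : ℕ) := (hf.comp_measurePreserving (hmp (y l))).sub hf
  have h4 := h1.mul_const ((∫ x, ‖g x‖ ^ (2 : ℝ) ∂AddCircle.haarAddCircle) ^ (1 / 2 : ℝ))
  rw [zero_mul] at h4
  refine squeeze_zero (fun l => integral_nonneg fun x => by positivity) (fun l => ?_) h4
  have e2 : ENNReal.ofReal 2 = 2 := by norm_num
  refine (integral_mul_norm_le_Lp_mul_Lq Real.HolderConjugate.two_two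
    (f := fun x => f (x + y l) - f x) (by rw [e2]; exact hd l) (by rw [e2]; exact hg)).trans
    (le_of_eq ?_)
  congr 1
  rw [← MemLp.toLp_sub, Lp.norm_toLp, (hd l).eLpNorm_eq_integral_rpow_norm (by norm_num)
    (by norm_num), ENNReal.toReal_ofReal (by positivity)]
  simp [Function.comp]

/-! ### Growth of the trace along approximate periods -/

/-- The matrix whose columns are two dual solutions. -/
def solutionMatrix (α : ℝ) (t t' : ℂ) (u w : UnitAddCircle → ℂ) (x : UnitAddCircle) :
    Matrix (Fin 2) (Fin 2) ℂ :=
  !![u x, w x; t' * u (rot α (-1) x), t * w (rot α (-1) x)]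

section Trace

variable {lam : Coupling} {α E : ℝ} {θ : UnitAddCircle} {u w : UnitAddCircle → ℂ}

theorem ae_iter_mul_solutionMatrix
    (hc : ∀ᵐ x : UnitAddCircle ∂AddCircle.haarAddCircle, c lam α x ≠ 0)
    (hu : IsDualSolution lam α E (fourier 1 θ) (fourier (-1) θ) u)
    (hw : IsDualSolution lam α E (fourier (-1) θ) (fourier 1 θ) w) :
    ∀ᵐ x : UnitAddCircle ∂AddCircle.haarAddCircle, ∀ n : ℕ,
      iter lam α E n x * solutionMatrix α (fourier 1 θ) (fourier (-1) θ) u w x =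
        solutionMatrix α (fourier 1 θ) (fourier (-1) θ) u w (rot α n x) * R θ ^ n := by
  filter_upwards [ae_forall_rot α hc, ae_forall_rot α hu, ae_forall_rot α hw] with x hcx hux hwx n
  induction n with
  | zero => simp [iter, rot_zero]
  | succ n ih =>
    have hstep : B lam α E (rot α n x) *
        solutionMatrix α (fourier 1 θ) (fourier (-1) θ) u w (rot α n x) =
        solutionMatrix α (fourier 1 θ) (fourier (-1) θ) u w (rot α (n + 1 : ℕ) x) * R θ := by
      have h1 := hux n
      have h2 := hwx n
      have h0 := hcx n
      have htt := fourier_mul_fourier_neg 1 θ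
      have e1 : rot α (n + 1 : ℕ) x = rot α 1 (rot α n x) := by
        rw [rot_rot]
        push_cast
        rfl
      rw [e1]
      generalize rot α n x = y at *
      rw [B, solutionMatrix, solutionMatrix, R, Matrix.smul_mul, Matrix.mul_fin_two,
        Matrix.mul_fin_two, rot_rot, add_neg_cancel, rot_zero]
      ext i j
      fin_cases i <;> fin_cases j <;>
        simp only [Fin.zero_eta, Fin.mk_one, Matrix.smul_apply, Matrix.of_apply, Matrix.cons_val',
          Matrix.cons_val_zero, Matrix.cons_val_one, Matrix.cons_val_fin_one, smul_eq_mul] <;>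
        rw [inv_mul_eq_iff_eq_mul₀ h0]
      · linear_combination h1
      · linear_combination h2
      · linear_combination (-c lam α y * u y) * htt
      · linear_combination (-c lam α y * w y) * htt
    rw [iter, mul_assoc, ih, ← mul_assoc, hstep, mul_assoc, ← pow_succ']

theorem ae_norm_wronskian_mul_trace_le
    (hc : ∀ᵐ x : UnitAddCircle ∂AddCircle.haarAddCircle, c lam α x ≠ 0)
    (hu : IsDualSolution lam α E (fourier 1 θ) (fourier (-1) θ) u)
    (hw : IsDualSolution lam α E (fourier (-1) θ) (fourier 1 θ) w) :
    ∀ᵐ x : UnitAddCircle ∂AddCircle.haarAddCircle, ∀ n : ℕ,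
      ‖wronskian α (fourier 1 θ) (fourier (-1) θ) u w x‖ * ‖(iter lam α E n x - R θ ^ n).trace‖ ≤
        ‖u (rot α n x) - u x‖ * ‖w (rot α (-1) x)‖ +
        ‖w (rot α n x) - w x‖ * ‖u (rot α (-1) x)‖ +
        ‖w (rot α (-1) (rot α n x)) - w (rot α (-1) x)‖ * ‖u x‖ +
        ‖u (rot α (-1) (rot α n x)) - u (rot α (-1) x)‖ * ‖w x‖ := by
  filter_upwards [ae_iter_mul_solutionMatrix hc hu hw] with x hx n
  have h := hx n
  rw [solutionMatrix, solutionMatrix, R_pow, Matrix.eta_fin_two (iter lam α E n x),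
    Matrix.mul_fin_two, Matrix.mul_fin_two] at h
  have h00 := congrFun (congrFun h 0) 0
  have h01 := congrFun (congrFun h 0) 1
  have h10 := congrFun (congrFun h 1) 0
  have h11 := congrFun (congrFun h 1) 1
  simp only [Matrix.of_apply, Matrix.cons_val', Matrix.cons_val_zero, Matrix.cons_val_one,
    Matrix.cons_val_fin_one, mul_zero, add_zero, zero_add] at h00 h01 h10 h11
  set ρ : ℂ := fourier n θ
  set ρ' : ℂ := fourier (-n) θ
  set t : ℂ := fourier 1 θ
  set t' : ℂ := fourier (-1) θ
  have hρ : ‖ρ‖ = 1 := norm_fourier_apply _ _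
  have hρ' : ‖ρ'‖ = 1 := norm_fourier_apply _ _
  have ht : ‖t‖ = 1 := norm_fourier_apply _ _
  have ht' : ‖t'‖ = 1 := norm_fourier_apply _ _
  have key : wronskian α t t' u w x * (iter lam α E n x - R θ ^ n).trace =
      ρ * t * ((u (rot α n x) - u x) * w (rot α (-1) x)) +
      -(ρ' * t') * ((w (rot α n x) - w x) * u (rot α (-1) x)) +
      ρ' * t * ((w (rot α (-1) (rot α n x)) - w (rot α (-1) x)) * u x) +
      -(ρ * t') * ((u (rot α (-1) (rot α n x)) - u (rot α (-1) x)) * w x) := by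
    rw [Matrix.trace_sub, Matrix.trace_fin_two, R_pow, Matrix.trace_fin_two_of, wronskian]
    linear_combination (t * w (rot α (-1) x)) * h00 - (t' * u (rot α (-1) x)) * h01 -
      w x * h10 + u x * h11
  rw [← norm_mul, key]
  refine (norm_add_le _ _).trans (add_le_add ((norm_add_le _ _).trans
    (add_le_add ((norm_add_le _ _).trans (add_le_add ?_ ?_)) ?_)) ?_) <;>
  simp only [norm_mul, norm_neg, hρ, hρ', ht, ht', one_mul, le_refl]

end Trace

/-! ### Approximate periods -/

theorem tendsto_coe_q_mul {α : ℝ} (hα : Irrational α) {n : ℕ → ℕ} (hn : StrictMono n) :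
    Tendsto (fun l => (((q α (n l) : ℝ) * α : ℝ) : UnitAddCircle)) atTop (nhds 0) := by
  have h1 := (tendsto_q_mul_sub hα).comp hn.tendsto_atTop
  have h2 : Tendsto (fun l => (q α (n l) : ℝ) * α - (α.convergent (n l)).num) atTop (nhds 0) :=
    (tendsto_zero_iff_abs_tendsto_zero _).mpr h1
  have h3 := ((AddCircle.continuous_mk' (1 : ℝ)).tendsto 0).comp h2
  have e0 : QuotientAddGroup.mk' (AddSubgroup.zmultiples (1 : ℝ)) 0 = 0 := map_zero _
  rw [e0] at h3
  refine h3.congr fun l => ?_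
  change (((q α (n l) : ℝ) * α - (α.convergent (n l)).num : ℝ) : UnitAddCircle) = _
  rw [AddCircle.coe_sub, sub_eq_self, AddCircle.coe_eq_zero_iff]
  exact ⟨(α.convergent (n l)).num, by simp⟩

theorem tendsto_concat {X : Type*} {l : Filter X} {F : ℕ → X} {a b : ℕ → ℕ}
    (ha : Tendsto (fun k => F (a k)) atTop l) (hb : Tendsto (fun k => F (b k)) atTop l) :
    Tendsto (fun k => F (concat a b k)) atTop l := by
  have hdiv : Tendsto (fun k : ℕ => k / 2) atTop atTop := Nat.tendsto_div_const_atTop two_ne_zero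
  intro S hS
  change ∀ᶠ k in atTop, F (concat a b k) ∈ S
  filter_upwards [hdiv.eventually (ha hS), hdiv.eventually (hb hS)] with k h1 h2
  rw [concat]
  split_ifs
  · exact h1
  · exact h2

theorem tendsto_coe_m_mul {α : ℝ} (hα : Irrational α) {n : ℕ → ℕ} (hn : StrictMono n) :
    Tendsto (fun l => (((m α n l : ℝ) * α : ℝ) : UnitAddCircle)) atTop (nhds 0) := by
  have h1 := tendsto_coe_q_mul hα hn
  refine tendsto_concat (F := fun k : ℕ => (((k : ℝ) * α : ℝ) : UnitAddCircle)) h1 ?_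
  have h2 := h1.add h1
  rw [add_zero] at h2
  refine h2.congr fun l => ?_
  rw [← AddCircle.coe_add]
  congr 1
  push_cast
  ring

theorem d_add (lam : Coupling) (α : ℝ) (j k : ℕ) (x : UnitAddCircle) :
    d lam α (j + k) x = d lam α j x * d lam α k (rot α j x) := by
  simp only [d, Finset.prod_range_add, rot_rot, Nat.cast_add]

theorem exists_norm_d_m_le {lam : Coupling} {α : ℝ} {n : ℕ → ℕ} (hn : IsErgodicSubseq lam α n) :
    ∃ K : ℝ, ∀ (l : ℕ) (x : UnitAddCircle),
      Real.exp (-(m α n l * I lam α)) * ‖d lam α (m α n l) x‖ ≤ Real.exp K := by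
  obtain ⟨-, C, hC⟩ := hn
  have hq (l : ℕ) (x : UnitAddCircle) :
      ‖d lam α (q α (n l)) x‖ ≤ Real.exp (q α (n l) * I lam α + |C|) :=
    (hC l x).trans (Real.exp_le_exp.mpr (add_le_add_right (le_abs_self C) _))
  refine ⟨2 * |C|, fun l x => ?_⟩
  have hd : ‖d lam α (m α n l) x‖ ≤ Real.exp (m α n l * I lam α + 2 * |C|) := by
    rw [m, concat]
    split_ifs
    · refine (hq _ x).trans (Real.exp_le_exp.mpr ?_)
      linarith [abs_nonneg C]
    · rw [two_mul (q α (n (l / 2))), d_add, norm_mul]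
      refine (mul_le_mul (hq _ x) (hq _ _) (norm_nonneg _) (Real.exp_pos _).le).trans_eq ?_
      rw [← Real.exp_add]
      congr 1
      push_cast
      ring
  refine (mul_le_mul_of_nonneg_left hd (Real.exp_pos _).le).trans_eq ?_
  rw [← Real.exp_add]
  congr 1
  ring

theorem integral_add_four {X : Type*} [MeasurableSpace X] {μ : Measure X} {f g h k : X → ℝ}
    (hf : Integrable f μ) (hg : Integrable g μ) (hh : Integrable h μ) (hk : Integrable k μ) :
    ∫ x, f x + g x + h x + k x ∂μ = ∫ x, f x ∂μ + ∫ x, g x ∂μ + ∫ x, h x ∂μ + ∫ x, k x ∂μ := by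
  have h2 : Integrable (fun x => f x + g x) μ := hf.add hg
  have h3 : Integrable (fun x => f x + g x + h x) μ := h2.add hh
  rw [integral_add h3 hk, integral_add h2 hh, integral_add hf hg]

theorem norm_fourierCoeff_le (f : UnitAddCircle → ℂ) (k : ℤ) :
    ‖fourierCoeff f k‖ ≤ ∫ x, ‖f x‖ ∂AddCircle.haarAddCircle := by
  rw [fourierCoeff]
  refine (norm_integral_le_integral_norm _).trans_eq ?_
  simp only [norm_smul, norm_fourier_apply, one_mul]

/-! ### Absence of point spectrum -/

theorem tendsto_boundaryCoeff_of_dualSolution {l1 l3 α E : ℝ} (hl : 1 ≤ l1 + l3)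
    (hα : Irrational α) {n : ℕ → ℕ} (hn : IsErgodicSubseq (dual l1 l3) α n) {θ : UnitAddCircle}
    (hθ : ¬ IsAlphaRational α θ) {u : UnitAddCircle → ℂ}
    (hu2 : MemLp u 2 AddCircle.haarAddCircle) (hum : Measurable u)
    (hu0 : ¬ (u =ᵐ[AddCircle.haarAddCircle] 0))
    (hu : IsDualSolution (dual l1 l3) α E (fourier 1 θ) (fourier (-1) θ) u) (s : ℤ) :
    Tendsto (fun l => boundaryCoeff (dual l1 l3) α E θ s (m α n l)) atTop (nhds 0) := by
  set w : UnitAddCircle → ℂ := fun x => u (-x) with hwdef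
  have hw2 : MemLp w 2 AddCircle.haarAddCircle :=
    hu2.comp_measurePreserving (Measure.measurePreserving_neg _)
  obtain ⟨b, hb0, hb⟩ := exists_pos_ae_norm_wronskian_eq hl hα hθ hum hu0 hu
  obtain ⟨K, hK⟩ := exists_norm_d_m_le hn
  set M := |(dual l1 l3).l1| + |(dual l1 l3).l2| + |(dual l1 l3).l3| with hM
  have hM0 : 0 ≤ M := by positivity
  have hu2' := memLp_comp_rot hu2 α (-1)
  have hw2' := memLp_comp_rot hw2 α (-1)
  have hy := tendsto_coe_m_mul hα hn.1
  set y : ℕ → UnitAddCircle := fun l => (((m α n l : ℝ) * α : ℝ) : UnitAddCircle) with hydef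
  have hlim := ((((tendsto_integral_norm_sub_mul_norm hu2 hw2' hy).add
    (tendsto_integral_norm_sub_mul_norm hw2 hu2' hy)).add
    (tendsto_integral_norm_sub_mul_norm hw2' hu2 hy)).add
    (tendsto_integral_norm_sub_mul_norm hu2' hw2 hy)).const_mul (Real.exp K * (M / b))
  simp only [add_zero, mul_zero] at hlim
  refine squeeze_zero (fun l => boundaryCoeff_nonneg _ _ _ _ _ _) (fun l => ?_) hlim
  have i1 := integrable_norm_sub_mul_norm hu2 hw2' (y l)
  have i2 := integrable_norm_sub_mul_norm hw2 hu2' (y l)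
  have i3 := integrable_norm_sub_mul_norm hw2' hu2 (y l)
  have i4 := integrable_norm_sub_mul_norm hu2' hw2 (y l)
  rw [← integral_add_four i1 i2 i3 i4, ← integral_const_mul, boundaryCoeff]
  refine (mul_le_mul_of_nonneg_left (norm_fourierCoeff_le _ _) (Real.exp_pos _).le).trans ?_
  rw [← integral_const_mul]
  refine integral_mono_of_nonneg (Eventually.of_forall fun x => by positivity)
    ((((i1.add i2).add i3).add i4).const_mul _) ?_
  filter_upwards [ae_norm_wronskian_mul_trace_le (ae_c_dual_ne_zero hl α) hu hu.comp_neg, hb]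
    with x hx hbx
  have h1 := hx (m α n l)
  have e1 : rot α (m α n l : ℕ) x = x + y l := by
    rw [rot, hydef]
    push_cast
    rfl
  rw [e1] at h1
  rw [Psi, Matrix.trace_smul, norm_smul, ← mul_assoc]
  refine (mul_le_mul_of_nonneg_right (hK l x) (norm_nonneg _)).trans ?_
  rw [mul_assoc]
  refine mul_le_mul_of_nonneg_left ?_ (Real.exp_pos _).le
  rw [div_mul_eq_mul_div, le_div_iff₀ hb0, mul_comm, ← hbx, mul_assoc]
  exact mul_le_mul (norm_c_le _ _ _) h1 (by positivity) hM0

theorem pointSpectrum_eq_empty {l1 l3 α : ℝ} (hl : 1 ≤ l1 + l3) (hα : Irrational α)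
    {n : ℕ → ℕ} (hn : IsErgodicSubseq (dual l1 l3) α n) {s : ℤ} {θ : UnitAddCircle}
    (hs : ∀ E : ℝ, 0 < limsup (fun l : ℕ =>
      ((boundaryCoeff (dual l1 l3) α E θ s (m α n l) : ℝ) : EReal)) atTop)
    (hθ : ¬ IsAlphaRational α θ) : pointSpectrum (H ⟨l1, 0, l3⟩ α θ) = ∅ := by
  refine Set.eq_empty_of_forall_notMem fun E hE => ?_
  obtain ⟨E', u, hu2, hum, hu0, hu⟩ := exists_dualSolution_of_mem_pointSpectrum hE
  have h1 := tendsto_boundaryCoeff_of_dualSolution hl hα hn hθ hu2 hum hu0 hu s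
  have h2 := (EReal.tendsto_coe.mpr h1).limsup_eq
  have h3 := hs E'
  rw [h2] at h3
  exact lt_irrefl _ h3

end EHM

theorem theoremD1 (α : ℝ) (hα : Irrational α) (l1 l3 : ℝ) (hl : 1 ≤ l1 + l3) :
    (∃ n : ℕ → ℕ, EHM.IsErgodicSubseq (EHM.dual l1 l3) α n) ∧
    (∀ n : ℕ → ℕ, EHM.IsErgodicSubseq (EHM.dual l1 l3) α n →
      ∀ᵐ θ : UnitAddCircle ∂AddCircle.haarAddCircle, ∀ E : ℝ,
        (l3 ≤ l1 → 0 < Filter.limsup (fun l : ℕ =>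
          ((EHM.boundaryCoeff (EHM.dual l1 l3) α E θ 1 (EHM.m α n l) : ℝ) : EReal))
          Filter.atTop) ∧
        (l1 ≤ l3 → 0 < Filter.limsup (fun l : ℕ =>
          ((EHM.boundaryCoeff (EHM.dual l1 l3) α E θ (-1) (EHM.m α n l) : ℝ) : EReal))
          Filter.atTop)) ∧
    (∀ᵐ θ : UnitAddCircle ∂AddCircle.haarAddCircle,
      ¬ EHM.IsAlphaRational α θ →
        EHM.pointSpectrum (EHM.H ⟨l1, 0, l3⟩ α θ) = ∅) := by
  have key (n : ℕ → ℕ) (hn : EHM.IsErgodicSubseq (EHM.dual l1 l3) α n) :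
      ∀ᵐ θ : UnitAddCircle ∂AddCircle.haarAddCircle, ∀ E : ℝ,
        (l3 ≤ l1 → 0 < Filter.limsup (fun l : ℕ =>
          ((EHM.boundaryCoeff (EHM.dual l1 l3) α E θ 1 (EHM.m α n l) : ℝ) : EReal))
          Filter.atTop) ∧
        (l1 ≤ l3 → 0 < Filter.limsup (fun l : ℕ =>
          ((EHM.boundaryCoeff (EHM.dual l1 l3) α E θ (-1) (EHM.m α n l) : ℝ) : EReal))
          Filter.atTop) := by
    have h1 (h : l3 ≤ l1) := EHM.ae_limsup_boundaryCoeff_pos hα hl (Or.inl ⟨rfl, h⟩) hn.1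
    have h2 (h : l1 ≤ l3) := EHM.ae_limsup_boundaryCoeff_pos hα hl (Or.inr ⟨rfl, h⟩) hn.1
    filter_upwards [Filter.eventually_imp_distrib_left.mpr h1,
      Filter.eventually_imp_distrib_left.mpr h2] with θ hθ1 hθ2 E
    exact ⟨fun h => hθ1 h E, fun h => hθ2 h E⟩
  obtain ⟨n, hn⟩ := EHM.exists_isErgodicSubseq hα hl
  refine ⟨⟨n, hn⟩, key, ?_⟩
  filter_upwards [key n hn] with θ hθ hr
  rcases le_total l3 l1 with h | h
  · exact EHM.pointSpectrum_eq_empty hl hα hn (fun E => (hθ E).1 h) hr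
  · exact EHM.pointSpectrum_eq_empty hl hα hn (fun E => (hθ E).2 h) hr
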